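/- Let $k\ge 2$ and let $\phi_1,\dots,\phi_k:(0,\infty)\to(0,\infty)$ satisfy: (C1) each $\phi_i$ is $C^1$, increasing (not necessarily strictly), and $\phi_i(x)\to\infty$ as $x\to\infty$; (C2) $\int_0^\infty e^{-c\phi_i(x)}\,dx<\infty$ for every $c>0$ and every $i$; (C3) there is $\kappa>1$ such that, for each $1\le i\le k-1$, $\phi_i(x)^\kappa<\phi_{i+1}(x)$ for all sufficiently large $x$; (C4) there are $C,M>0$ such that $\frac1C\phi_i(x)^{-M}<\phi_i'(x)<C\phi_i(x)^M$ for all $x>C$ and all $i$. Let $\mathcal M_1$ be the set of Borel probability measures on $(0,\infty)$ with the weak topology. For $\mu\in\mathcal M_1$ let $h(\mu)=-\int_0^\infty \frac{d\mu}{dx}\log\frac{d\mu}{dx}\,dx$ be the differential entropy if $\mu\ll dx$, and $h(\mu)=-\infty$ otherwise (also if the positive and the negative part of the integrand both have infinite integral). Let $\mathcal A_1$ be the interior of the set of $(v_1,\dots,v_{k-1})\in(0,\infty)^{k-1}$ for which some $\mu\in\mathcal M_1$ satisfies $h(\mu)\ne-\infty$, $\int\phi_i\,d\mu=v_i$ for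 $i<k$, and $\int\phi_k\,d\mu<\infty$. For $v\in\mathcal A_1$ let $$g_1(v)=\inf\Big\{\int\phi_k\,d\mu \;:\; \mu\in\mathcal M_1,\ h(\mu)\neq-\infty,\ \int\phi_i\,d\mu=v_i\ (1\le i\le k-1)\Big\},$$ and assume that $g_1$ is continuous on $\mathcal A_1$. Let $a=(a_1,\dots,a_k)$ satisfy $(a_1,\dots,a_{k-1})\in\mathcal A_1$ and $a_k>g_1(a_1,\dots,a_{k-1})$. Let $\lambda=\frac1Z e^{-\phi_1}\,dx$ be a probability measure on $(0,\infty)$, let $\mathbb P=\lambda^{\otimes\mathbb N}$ on $(0,\infty)^{\mathbb N}$ with coordinates $X_1,X_2,\dots$, and for $\delta>0$ let $$C_n^\delta=\bigcap_{i=1}^k\Big\{\Big|\frac{\phi_i(X_1)+\cdots+\phi_i(X_n)}n-a_i\Big|\le\delta\Big\}.$$ Then for every $\delta>0$ one has $\mathbb P(C_n^\delta)>0$ for all sufficiently large $n$. The differential entropy $h$ has a unique maximizer $\lambda^*$ over the set $$\Big\{\mu\in\mathcal M_1 \;:\; \int\phi_i\,d\mu=a_i\ (1\le i\le k-1),\ \int\phi_k\,d\mu\le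 a_k\Big\},$$ and for every fixed $j$, $$\lim_{\delta\to0}\ \lim_{n\to\infty}\ \mathbb P\big((X_1,\dots,X_j)\in\cdot\mid C_n^\delta\big)=(\lambda^*)^{\otimes j}$$ in the sense of weak convergence on $(0,\infty)^j$: for each $\delta>0$ the inner limit exists and is a probability measure, and these limits converge to $(\lambda^*)^{\otimes j}$ as $\delta\downarrow0$. -/

import Mathlib

open MeasureTheory ProbabilityTheory Filter Topology

noncomputable section

namespace Microcanonical

/-- The half line `(0, ∞)`, with the topology and the Borel σ-algebra it inherits from `ℝ`. -/
abbrev PosReal : Type := Set.Ioi (0 : ℝ)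

/-- The Lebesgue measure `dx` on `(0, ∞)`. -/
def leb : Measure PosReal := (volume : Measure ℝ).comap Subtype.val

/-- The configuration space `(0, ∞)^ℕ`; the coordinate of index `l` (from `0`) is `X_{l+1}`. -/
abbrev Config : Type := ℕ → PosReal

instance instNeZeroLeb : NeZero leb := by
  refine ⟨fun h => ?_⟩
  have h1 : leb Set.univ = 0 := by rw [h]; rfl
  rw [leb, comap_subtype_coe_apply measurableSet_Ioi, Set.image_univ, Subtype.range_coe,
    Real.volume_Ioi] at h1
  exact ENNReal.top_ne_zero h1

/-- The standing assumptions on the observables. There are `k = m + 1 ≥ 2` of them, with indices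
shifted by one: `φ 0, …, φ (Fin.last m)` stand for `φ_1, …, φ_k`. Only the values on `(0, ∞)`
matter. -/
structure Observables {m : ℕ} (φ : Fin (m + 1) → ℝ → ℝ) : Prop where
  two_le : 2 ≤ m + 1
  pos : ∀ i, ∀ x : ℝ, 0 < x → 0 < φ i x
  contDiffOn : ∀ i, ContDiffOn ℝ 1 (φ i) (Set.Ioi 0)
  monotoneOn : ∀ i, MonotoneOn (φ i) (Set.Ioi 0)
  tendsto_atTop : ∀ i, Tendsto (φ i) atTop atTop
  integrable_exp : ∀ i, ∀ c : ℝ, 0 < c → IntegrableOn (fun x => Real.exp (-c * φ i x)) (Set.Ioi 0)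
  /-- The next observable grows faster at infinity. -/
  growth : ∃ κ : ℝ, 1 < κ ∧ ∀ i : Fin m, ∀ᶠ x in atTop, φ i.castSucc x ^ κ < φ i.succ x
  deriv_bounds : ∃ C M : ℝ, 0 < C ∧ 0 < M ∧ ∀ i, ∀ x > C,
    1 / C * φ i x ^ (-M) < deriv (φ i) x ∧ deriv (φ i) x < C * φ i x ^ M

/-- The integral `∫ f dμ ∈ [0, ∞]` of a function which is positive on `(0, ∞)`. -/
def moment (f : ℝ → ℝ) (μ : ProbabilityMeasure PosReal) : ENNReal :=
  ∫⁻ x : PosReal, ENNReal.ofReal (f x) ∂(μ : Measure PosReal)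

open Classical in
/-- The differential entropy `h(μ) = -∫ ρ log ρ dx`, with `ρ = dμ/dx`, if `μ ≪ dx`, and `-∞`
otherwise. The integral is the difference of the integrals of the positive and negative parts of
`-ρ log ρ`, and it is `-∞` by convention if both are infinite. (If `∫ φ_1 dμ` is finite, then the
positive part has a finite integral.) -/
def entropy (μ : ProbabilityMeasure PosReal) : EReal :=
  if (μ : Measure PosReal) ≪ leb then
    ((∫⁻ x : PosReal, ENNReal.ofReal
        (Real.negMulLog ((μ : Measure PosReal).rnDeriv leb x).toReal) ∂leb : ENNReal) : EReal)
      - ((∫⁻ x : PosReal, ENNReal.ofReal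
        (-Real.negMulLog ((μ : Measure PosReal).rnDeriv leb x).toReal) ∂leb : ENNReal) : EReal)
  else ⊥

variable {m : ℕ}

/-- The set `𝒜₁ ⊆ (0, ∞)^(k-1)`. -/
def admissible₁ (φ : Fin (m + 1) → ℝ → ℝ) : Set (Fin m → ℝ) :=
  interior {v | (∀ i, 0 < v i) ∧ ∃ μ : ProbabilityMeasure PosReal, entropy μ ≠ ⊥ ∧
    (∀ i : Fin m, moment (φ i.castSucc) μ = ENNReal.ofReal (v i)) ∧
    moment (φ (Fin.last m)) μ < ⊤}

/-- The function `g₁(v) = inf {∫ φ_k dμ | h(μ) ≠ -∞, ∫ φ_i dμ = v_i for i < k}`, used on `𝒜₁`,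
where it is finite. -/
def g₁ (φ : Fin (m + 1) → ℝ → ℝ) (v : Fin m → ℝ) : ENNReal :=
  sInf {t | ∃ μ : ProbabilityMeasure PosReal, entropy μ ≠ ⊥ ∧
    (∀ i : Fin m, moment (φ i.castSucc) μ = ENNReal.ofReal (v i)) ∧
    t = moment (φ (Fin.last m)) μ}

/-- The admissible set `𝒜`. -/
def admissible (φ : Fin (m + 1) → ℝ → ℝ) : Set (Fin (m + 1) → ℝ) :=
  {a | (fun i : Fin m => a i.castSucc) ∈ admissible₁ φ ∧
    g₁ φ (fun i : Fin m => a i.castSucc) < ENNReal.ofReal (a (Fin.last m))}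

/-- The probability measures with `∫ φ_i dμ = a_i` for `i < k` and `∫ φ_k dμ ≤ a_k`. -/
def relaxedSet (φ : Fin (m + 1) → ℝ → ℝ) (a : Fin (m + 1) → ℝ) :
    Set (ProbabilityMeasure PosReal) :=
  {μ | (∀ i : Fin m, moment (φ i.castSucc) μ = ENNReal.ofReal (a i.castSucc)) ∧
    moment (φ (Fin.last m)) μ ≤ ENNReal.ofReal (a (Fin.last m))}

/-- `μ₀` is the unique maximizer of the differential entropy over `T`. -/
def IsUniqueEntropyMaximizer (T : Set (ProbabilityMeasure PosReal))
    (μ₀ : ProbabilityMeasure PosReal) : Prop :=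
  μ₀ ∈ T ∧ ∀ μ ∈ T, μ ≠ μ₀ → entropy μ < entropy μ₀

variable {φ : Fin (m + 1) → ℝ → ℝ}

theorem Observables.integrable_exp_neg (hφ : Observables φ) :
    Integrable (fun x : PosReal => Real.exp (-φ 0 x)) leb := by
  have h := hφ.integrable_exp 0 1 one_pos
  simp only [neg_mul, one_mul] at h
  exact (integrableOn_iff_comap_subtypeVal measurableSet_Ioi).1 h

/-- The reference law `λ = Z⁻¹ e^{-φ_1} dx` on `(0, ∞)`. -/
def refLaw (hφ : Observables φ) : ProbabilityMeasure PosReal :=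
  ⟨leb.tilted fun x => -φ 0 x,
    isProbabilityMeasure_tilted hφ.integrable_exp_neg⟩

/-- The reference measure `ℙ = λ^{⊗ℕ}` on the configuration space. -/
def refMeasure (hφ : Observables φ) : Measure Config :=
  Measure.infinitePi fun _ : ℕ => (refLaw hφ : Measure PosReal)

/-- The empirical mean `(f(X_1) + ⋯ + f(X_n)) / n`. -/
def empMean (f : ℝ → ℝ) (n : ℕ) (ω : Config) : ℝ :=
  (∑ l ∈ Finset.range n, f (ω l)) / n

/-- The constraint `C_n^δ`. -/
def constraint (φ : Fin (m + 1) → ℝ → ℝ) (a : Fin (m + 1) → ℝ) (δ : ℝ) (n : ℕ) : Set Config :=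
  {ω | ∀ i, |empMean (φ i) n ω - a i| ≤ δ}

/-- The law of `(X_1, …, X_j)` under `ℙ(· | C_n^δ)`. It is a probability measure as soon as
`ℙ(C_n^δ) > 0`; otherwise it is the zero measure. -/
def condMarginal (hφ : Observables φ) (a : Fin (m + 1) → ℝ) (δ : ℝ) (n j : ℕ) :
    FiniteMeasure (Fin j → PosReal) :=
  ⟨((refMeasure hφ)[|constraint φ a δ n]).map fun ω (l : Fin j) => ω l, inferInstance⟩

end Microcanonical

end

noncomputable section

namespace Microcanonical
open InformationTheory

/-! ### Convexity of `klFun` -/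

/-! The argument is Gibbs conditioning through entropy projections. Let `ν` be the reference law and
`feasible` the convex set of densities whose moments are within `δ` of `a`, with only an upper bound
on the last one. A one-sided bound is what survives limits: the lower observables are negligible
against the last one at infinity, so their moments pass to the limit, while part of the last moment
may escape. Thus `feasible` is closed (`isSeqClosedAE_feasible`), and the relative entropy has a
minimizer `p_δ` on it: by strong convexity (`kl_midpoint`) near-minimizers are Cauchy in Hellinger
distance, i.e. their square roots are Cauchy in L².

Upper bound. Under the conditional law the coordinates are exchangeable, so the law of one
coordinate has a density in `feasible`. The variational inequality at `p_δ`
(`kl_le_integral_mul_log`) then gives `∑ log p_δ(X_l)` a conditional mean of at least `n * kl p_δ`.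
The product of the `p_δ(X_l)` is the density of the i.i.d. law `p_δ`, so Jensen's inequality bounds
the conditional mean of any bounded function of a block of `j` coordinates by its exponential moment
under `p_δ^{⊗j}`, up to the error `-log ℙ(C) - n * kl p_δ` shared among about `n / j` blocks
(`mul_kl_add_le`).

Lower bound. That error is `o(n)` (`eventually_exp_le_of_isMin`). Tilt to a law near `p_δ` that
satisfies the relaxed constraints strictly; the law of large numbers costs `exp(-n * kl)` up to
`exp(o(n))`. If its last moment is too small, a single extra coordinate supplies the missing amount:
by the polynomial derivative bound, and since `φ_1` is small compared with `φ_k`, this costs only a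
subexponential factor (`Observables.subexponentialTail`).

So the conditional law of `j` coordinates tends to `p_δ^{⊗j}`. As `δ → 0` the minimal relative
entropies converge, by compactness of nested feasible sets (`exists_mem_iInter_kl_le`), whence `p_δ
→ p_0` in L¹. Finally `h(μ) = ∫ φ_1 dμ + log Z - kl` (`entropy_eq`), and `∫ φ_1 dμ` is fixed on the
relaxed set because `k ≥ 2`; hence `p_0` is the density of the unique entropy maximizer. -/

/-- The right side is `x log (x / y) - x + y`; apply `log s ≤ s - 1` to `s = √y / √x` and multiply
by `2x`. -/
theorem bregman_ge_hellinger {x y : ℝ} (hx : 0 ≤ x) (hy : 0 < y) :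
    (√x - √y) ^ 2 ≤ klFun x - klFun y - Real.log y * (x - y) := by
  have e2 : √y ^ 2 = y := Real.sq_sqrt hy.le
  rcases hx.eq_or_lt with rfl | hx
  · simp only [klFun_apply, Real.sqrt_zero, zero_mul, zero_sub, neg_sq, e2]
    linarith
  have e1 : √x ^ 2 = x := Real.sq_sqrt hx.le
  have sx := Real.sqrt_pos.2 hx
  have sy := Real.sqrt_pos.2 hy
  have h : Real.log (√y / √x) ≤ √y / √x - 1 := Real.log_le_sub_one_of_pos (by positivity)
  rw [Real.log_div sy.ne' sx.ne', Real.log_sqrt hy.le, Real.log_sqrt hx.le] at h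
  have h2 := mul_le_mul_of_nonneg_left h (by positivity : 0 ≤ 2 * x)
  have h3 : 2 * x * (√y / √x - 1) = 2 * √x * √y - 2 * x := by
    field_simp
    linear_combination -√y * e1
  rw [h3] at h2
  simp only [klFun_apply]
  nlinarith

/-- Average the Bregman bounds of `x` and `y` at their midpoint: the linear terms cancel, and the
two squares add up to at least half of `(√x - √y) ^ 2`. This strong convexity is the source of both
existence and uniqueness of minimizers. -/
theorem klFun_midpoint {x y : ℝ} (hx : 0 ≤ x) (hy : 0 ≤ y) :
    klFun ((x + y) / 2) + (√x - √y) ^ 2 / 4 ≤ (klFun x + klFun y) / 2 := by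
  rcases (add_nonneg hx hy).eq_or_lt with h | h
  · obtain rfl : x = 0 := by linarith
    obtain rfl : y = 0 := by linarith
    simp
  · have h1 := bregman_ge_hellinger hx (half_pos h)
    have h2 := bregman_ge_hellinger hy (half_pos h)
    nlinarith [sq_nonneg (√x + √y - 2 * √((x + y) / 2))]

theorem klFun_combo_le {x y t : ℝ} (hx : 0 ≤ x) (hy : 0 ≤ y) (h0 : 0 ≤ t) (h1 : t ≤ 1) :
    klFun ((1 - t) * x + t * y) ≤ (1 - t) * klFun x + t * klFun y := by
  simpa using convexOn_klFun.2 (Set.mem_Ici.2 hx) (Set.mem_Ici.2 hy) (sub_nonneg.2 h1) h0 (by ring)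

/-! ### Relative entropy of densities and Hellinger distance -/

variable {Ω : Type*} [MeasurableSpace Ω]

/-- `p` is a probability density with respect to `ν`. -/
structure IsDensity (ν : Measure Ω) (p : Ω → ℝ) : Prop where
  measurable : Measurable p
  nonneg : ∀ x, 0 ≤ p x
  integrable : Integrable p ν
  integral_eq_one : ∫ x, p x ∂ν = 1

/-- The relative entropy of the law with density `p`. -/
def kl (ν : Measure Ω) (p : Ω → ℝ) : ℝ := ∫ x, klFun (p x) ∂ν

/-- The law with density `p` has finite relative entropy. -/
def FiniteKL (ν : Measure Ω) (p : Ω → ℝ) : Prop := Integrable (fun x => klFun (p x)) ν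

/-- Stability of a set of functions under almost sure convergence to a density. -/
def IsSeqClosedAE (ν : Measure Ω) (S : Set (Ω → ℝ)) : Prop :=
  ∀ (u : ℕ → Ω → ℝ) (p : Ω → ℝ), (∀ n, u n ∈ S) → IsDensity ν p →
    (∀ᵐ x ∂ν, Tendsto (fun n => u n x) atTop (𝓝 (p x))) → p ∈ S

variable {ν : Measure Ω} {p q : Ω → ℝ}

theorem IsDensity.klFun_nonneg (hp : IsDensity ν p) (x : Ω) : 0 ≤ klFun (p x) :=
  InformationTheory.klFun_nonneg (hp.nonneg x)

theorem IsDensity.measurable_klFun (hp : IsDensity ν p) : Measurable fun x => klFun (p x) :=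
  InformationTheory.measurable_klFun.comp hp.measurable

theorem kl_nonneg (hp : IsDensity ν p) : 0 ≤ kl ν p :=
  integral_nonneg fun x => hp.klFun_nonneg x

theorem IsDensity.combo (hp : IsDensity ν p) (hq : IsDensity ν q) {t : ℝ} (h0 : 0 ≤ t)
    (h1 : t ≤ 1) : IsDensity ν fun x => (1 - t) * p x + t * q x where
  measurable := (hp.measurable.const_mul _).add (hq.measurable.const_mul _)
  nonneg x := add_nonneg (mul_nonneg (sub_nonneg.2 h1) (hp.nonneg x)) (mul_nonneg h0 (hq.nonneg x))
  integrable := (hp.integrable.const_mul _).add (hq.integrable.const_mul _)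
  integral_eq_one := by
    rw [integral_add (hp.integrable.const_mul _) (hq.integrable.const_mul _),
      integral_const_mul, integral_const_mul, hp.integral_eq_one, hq.integral_eq_one]
    ring

theorem FiniteKL.combo (hp : IsDensity ν p) (hq : IsDensity ν q) (fp : FiniteKL ν p)
    (fq : FiniteKL ν q) {t : ℝ} (h0 : 0 ≤ t) (h1 : t ≤ 1) :
    FiniteKL ν (fun x => (1 - t) * p x + t * q x) ∧
      kl ν (fun x => (1 - t) * p x + t * q x) ≤ (1 - t) * kl ν p + t * kl ν q := by
  have hd := hp.combo hq h0 h1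
  have hi : Integrable (fun x => (1 - t) * klFun (p x) + t * klFun (q x)) ν :=
    (fp.const_mul _).add (fq.const_mul _)
  have hle x := klFun_combo_le (hp.nonneg x) (hq.nonneg x) h0 h1
  have hf : FiniteKL ν (fun x => (1 - t) * p x + t * q x) :=
    hi.mono' hd.measurable_klFun.aestronglyMeasurable
      (.of_forall fun x => by rw [Real.norm_of_nonneg (hd.klFun_nonneg x)]; exact hle x)
  refine ⟨hf, ?_⟩
  have := integral_mono hf hi hle
  rwa [integral_add (fp.const_mul _) (fq.const_mul _), integral_const_mul,
    integral_const_mul] at this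

theorem integrable_hellinger (hp : IsDensity ν p) (hq : IsDensity ν q) :
    Integrable (fun x => (√(p x) - √(q x)) ^ 2) ν := by
  refine ((hp.integrable.add hq.integrable).const_mul 2).mono'
    ((hp.measurable.sqrt.sub hq.measurable.sqrt).pow_const 2).aestronglyMeasurable
    (.of_forall fun x => ?_)
  rw [Real.norm_of_nonneg (sq_nonneg _)]
  simp only [Pi.add_apply]
  nlinarith [Real.sq_sqrt (hp.nonneg x), Real.sq_sqrt (hq.nonneg x),
    sq_nonneg (√(p x) + √(q x))]

theorem kl_midpoint (hp : IsDensity ν p) (hq : IsDensity ν q) (fp : FiniteKL ν p)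
    (fq : FiniteKL ν q) :
    kl ν (fun x => (1 - 1 / 2) * p x + 1 / 2 * q x) + (∫ x, (√(p x) - √(q x)) ^ 2 ∂ν) / 4 ≤
      (kl ν p + kl ν q) / 2 := by
  have h := (fp.combo hp hq fq (t := 1 / 2) (by norm_num) (by norm_num)).1
  have hH := integrable_hellinger hp hq
  have := integral_mono (h.add (hH.div_const 4)) ((fp.add fq).div_const 2) (fun x => by
    have := klFun_midpoint (hp.nonneg x) (hq.nonneg x)
    rw [show (p x + q x) / 2 = (1 - 1 / 2) * p x + 1 / 2 * q x by ring] at this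
    exact this)
  simp only [Pi.add_apply] at this
  rwa [integral_add h (hH.div_const 4), integral_div, integral_div, integral_add fp fq] at this

theorem convex_mid {α : Type*} {S : Set (α → ℝ)} {p q : α → ℝ} (hS : Convex ℝ S)
    (hp : p ∈ S) (hq : q ∈ S) {t : ℝ}
    (h0 : 0 ≤ t) (h1 : t ≤ 1) : (fun x => (1 - t) * p x + t * q x) ∈ S :=
  hS hp hq (sub_nonneg.2 h1) h0 (by ring)

/-- If `p` minimizes the relative entropy over a convex set then the Hellinger distance of `p` to
another point is controlled by the excess of relative entropy. -/
theorem hellinger_le_of_isMin {S : Set (Ω → ℝ)} (hS : Convex ℝ S) (hd : ∀ p ∈ S, IsDensity ν p)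
    (hp : p ∈ S) (fp : FiniteKL ν p) (hmin : ∀ q ∈ S, FiniteKL ν q → kl ν p ≤ kl ν q)
    (hq : q ∈ S) (fq : FiniteKL ν q) :
    ∫ x, (√(p x) - √(q x)) ^ 2 ∂ν ≤ 2 * (kl ν q - kl ν p) := by
  have h := kl_midpoint (hd p hp) (hd q hq) fp fq
  have := hmin _ (convex_mid hS hp hq (t := 1 / 2) (by norm_num) (by norm_num))
    ((fp.combo (hd p hp) (hd q hq) fq (by norm_num) (by norm_num)).1)
  linarith

/-- Factor `p - q` as `(√p - √q)(√p + √q)` and use Young's inequality with weight `c`; the second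
factor has squared integral at most 4. -/
theorem integral_abs_sub_le (hp : IsDensity ν p) (hq : IsDensity ν q) {c : ℝ} (hc : 0 < c) :
    ∫ x, |p x - q x| ∂ν ≤ (∫ x, (√(p x) - √(q x)) ^ 2 ∂ν) / (2 * c) + 2 * c := by
  have hH := integrable_hellinger hp hq
  have hs : Integrable (fun x => c * (p x + q x)) ν := (hp.integrable.add hq.integrable).const_mul c
  have := integral_mono (hp.integrable.sub hq.integrable).abs
    ((hH.div_const (2 * c)).add hs) (fun x => by
    have ep := Real.sq_sqrt (hp.nonneg x)
    have eq := Real.sq_sqrt (hq.nonneg x)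
    simp only [Pi.add_apply, Pi.sub_apply]
    have e : p x - q x = (√(p x) - √(q x)) * (√(p x) + √(q x)) := by
      rw [← sub_eq_zero]; linear_combination eq - ep
    rw [e, abs_mul, abs_of_nonneg (a := √(p x) + √(q x)) (by positivity), ← sq_abs,
      div_add' _ _ _ (by positivity), le_div_iff₀ (by positivity)]
    set u := |√(p x) - √(q x)|
    have hb : (√(p x) + √(q x)) ^ 2 ≤ 2 * (p x + q x) := by
      nlinarith [sq_nonneg (√(p x) - √(q x))]
    nlinarith [sq_nonneg (u - c * (√(p x) + √(q x))), mul_le_mul_of_nonneg_left hb (sq_nonneg c)])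
  simp only [Pi.add_apply, Pi.sub_apply] at this
  rw [integral_add (hH.div_const _) hs, integral_div, integral_const_mul,
    integral_add hp.integrable hq.integrable, hp.integral_eq_one, hq.integral_eq_one] at this
  linarith

/-! ### Lower semicontinuity, completeness and existence of minimizers -/

theorem lintegral_klFun (hp : IsDensity ν p) (fp : FiniteKL ν p) :
    ∫⁻ x, ENNReal.ofReal (klFun (p x)) ∂ν = ENNReal.ofReal (kl ν p) :=
  (ofReal_integral_eq_lintegral_ofReal fp (.of_forall hp.klFun_nonneg)).symm

theorem finiteKL_of_lintegral_le (hp : IsDensity ν p) {K : ℝ} (hK : 0 ≤ K)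
    (h : ∫⁻ x, ENNReal.ofReal (klFun (p x)) ∂ν ≤ ENNReal.ofReal K) :
    FiniteKL ν p ∧ kl ν p ≤ K := by
  have hf : FiniteKL ν p := by
    refine ⟨hp.measurable_klFun.aestronglyMeasurable, ?_⟩
    rw [hasFiniteIntegral_iff_ofReal (.of_forall hp.klFun_nonneg)]
    exact h.trans_lt ENNReal.ofReal_lt_top
  refine ⟨hf, ?_⟩
  rw [lintegral_klFun hp hf] at h
  exact (ENNReal.ofReal_le_ofReal_iff hK).1 h

/-- Lower semicontinuity of the relative entropy. -/
theorem kl_le_of_tendsto_ae {u : ℕ → Ω → ℝ} (hu : ∀ n, IsDensity ν (u n)) (hp : IsDensity ν p)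
    (fu : ∀ n, FiniteKL ν (u n)) {b : ℕ → ℝ} {K : ℝ} (hb : ∀ n, kl ν (u n) ≤ b n)
    (hK : Tendsto b atTop (𝓝 K))
    (h : ∀ᵐ x ∂ν, Tendsto (fun n => u n x) atTop (𝓝 (p x))) : FiniteKL ν p ∧ kl ν p ≤ K := by
  have hK0 : 0 ≤ K := ge_of_tendsto' hK fun n => (kl_nonneg (hu n)).trans (hb n)
  refine finiteKL_of_lintegral_le hp hK0 ?_
  calc ∫⁻ x, ENNReal.ofReal (klFun (p x)) ∂ν
      = ∫⁻ x, liminf (fun n => ENNReal.ofReal (klFun (u n x))) atTop ∂ν := by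
        refine lintegral_congr_ae (h.mono fun x hx => ?_)
        exact (((ENNReal.continuous_ofReal.comp continuous_klFun).tendsto _).comp hx).liminf_eq.symm
    _ ≤ liminf (fun n => ∫⁻ x, ENNReal.ofReal (klFun (u n x)) ∂ν) atTop :=
        lintegral_liminf_le fun n => (hu n).measurable_klFun.ennreal_ofReal
    _ ≤ liminf (fun n => ENNReal.ofReal (b n)) atTop := by
        refine liminf_le_liminf (.of_forall fun n => ?_)
        rw [lintegral_klFun (hu n) (fu n)]
        exact ENNReal.ofReal_le_ofReal (hb n)
    _ = ENNReal.ofReal K := ((ENNReal.continuous_ofReal.tendsto _).comp hK).liminf_eq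

theorem IsDensity.memLp_sqrt (hp : IsDensity ν p) : MemLp (fun x => √(p x)) 2 ν := by
  rw [memLp_two_iff_integrable_sq hp.measurable.sqrt.aestronglyMeasurable]
  exact hp.integrable.congr (.of_forall fun x => (Real.sq_sqrt (hp.nonneg x)).symm)

theorem norm_sq_eq_integral (f : Lp ℝ 2 ν) : ‖f‖ ^ 2 = ∫ x, f x ^ 2 ∂ν := by
  rw [← real_inner_self_eq_norm_sq, L2.inner_def]
  exact integral_congr_ae (.of_forall fun x => by simp [sq])

/-- Completeness of the set of densities for the Hellinger distance. -/
theorem exists_density_of_hellinger_cauchy {u : ℕ → Ω → ℝ} (hu : ∀ n, IsDensity ν (u n))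
    {b : ℕ → ℝ} (hb : Tendsto b atTop (𝓝 0))
    (h : ∀ n k, n ≤ k → ∫ x, (√(u n x) - √(u k x)) ^ 2 ∂ν ≤ b n) :
    ∃ (p : Ω → ℝ) (ns : ℕ → ℕ), IsDensity ν p ∧ StrictMono ns ∧
      ∀ᵐ x ∂ν, Tendsto (fun n => u (ns n) x) atTop (𝓝 (p x)) := by
  let F n : Lp ℝ 2 ν := (hu n).memLp_sqrt.toLp
  have hF n : F n =ᵐ[ν] fun x => √(u n x) := MemLp.coeFn_toLp _
  have hdist n k (hnk : n ≤ k) : dist (F n) (F k) ≤ √(b n) := by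
    refine Real.le_sqrt_of_sq_le ?_
    rw [dist_eq_norm, norm_sq_eq_integral]
    refine le_trans (le_of_eq (integral_congr_ae ?_)) (h n k hnk)
    filter_upwards [hF n, hF k, Lp.coeFn_sub (F n) (F k)] with x h1 h2 h3
    rw [h3, Pi.sub_apply, h1, h2]
  have hc : CauchySeq F := by
    refine cauchySeq_of_le_tendsto_0 (fun n => 2 * √(b n)) (fun n k N hn hk => ?_) ?_
    · have := dist_triangle_left (F n) (F k) (F N)
      linarith [hdist N n hn, hdist N k hk]
    · simpa using ((Real.continuous_sqrt.tendsto 0).comp hb).const_mul 2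
  obtain ⟨g, hg⟩ := cauchySeq_tendsto_of_complete hc
  obtain ⟨ns, hns, hae⟩ := (tendstoInMeasure_of_tendsto_Lp hg).exists_seq_tendsto_ae
  -- The square roots converge in L² norm, so no mass is lost in the limit.
  have hnorm : ‖g‖ ^ 2 = 1 := by
    refine tendsto_nhds_unique ((hg.norm).pow 2) ?_
    refine tendsto_const_nhds.congr fun n => ?_
    rw [norm_sq_eq_integral, ← (hu n).integral_eq_one]
    refine integral_congr_ae ((hF n).mono fun x hx => ?_)
    simp only [hx, Real.sq_sqrt ((hu n).nonneg x)]
  refine ⟨fun x => g x ^ 2, ns, ⟨?_, fun x => sq_nonneg _, ?_, ?_⟩, hns, ?_⟩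
  · exact (Lp.stronglyMeasurable g).measurable.pow_const 2
  · exact (memLp_two_iff_integrable_sq (Lp.aestronglyMeasurable g)).1 (Lp.memLp g)
  · rw [← norm_sq_eq_integral, hnorm]
  · have hall : ∀ᵐ x ∂ν, ∀ n, F n x = √(u n x) := ae_all_iff.2 hF
    filter_upwards [hae, hall] with x hx hF
    refine (hx.pow 2).congr fun n => ?_
    rw [hF, Real.sq_sqrt ((hu _).nonneg x)]

/-- A nested sequence of closed convex sets of densities, each of which contains a point of relative
entropy at most `K`, has a common point of relative entropy at most `K`. -/
theorem exists_mem_iInter_kl_le {S : ℕ → Set (Ω → ℝ)} (hS : ∀ n, Convex ℝ (S n))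
    (hd : ∀ n, ∀ p ∈ S n, IsDensity ν p) (hcl : ∀ n, IsSeqClosedAE ν (S n)) (hanti : Antitone S)
    {K : ℝ} (hK : ∀ n, ∃ p ∈ S n, FiniteKL ν p ∧ kl ν p ≤ K) :
    ∃ p, (∀ n, p ∈ S n) ∧ FiniteKL ν p ∧ kl ν p ≤ K ∧
      ∀ K', (∀ n, ∃ p ∈ S n, FiniteKL ν p ∧ kl ν p ≤ K') → kl ν p ≤ K' := by
  let V n : Set ℝ := kl ν '' {p | p ∈ S n ∧ FiniteKL ν p}
  have hbdd n : BddBelow (V n) := ⟨0, by rintro _ ⟨p, hp, rfl⟩; exact kl_nonneg (hd n p hp.1)⟩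
  have hne n : (V n).Nonempty := by
    obtain ⟨p, hp, fp, -⟩ := hK n
    exact ⟨_, p, ⟨hp, fp⟩, rfl⟩
  let J n := sInf (V n)
  have hJ n {p} (hp : p ∈ S n) (fp : FiniteKL ν p) : J n ≤ kl ν p :=
    csInf_le (hbdd n) ⟨p, ⟨hp, fp⟩, rfl⟩
  have hJmono : Monotone J := fun n k hnk =>
    csInf_le_csInf (hbdd n) (hne k) (Set.image_mono fun p hp => ⟨hanti hnk hp.1, hp.2⟩)
  have hJK K' (h : ∀ n, ∃ p ∈ S n, FiniteKL ν p ∧ kl ν p ≤ K') n : J n ≤ K' := by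
    obtain ⟨p, hp, fp, hk⟩ := h n
    exact (hJ n hp fp).trans hk
  have hJb : BddAbove (Set.range J) := ⟨K, by rintro _ ⟨n, rfl⟩; exact hJK K hK n⟩
  have hJlim := tendsto_atTop_ciSup hJmono hJb
  set L := ⨆ n, J n
  have hone : Tendsto (fun n : ℕ => 1 / ((n : ℝ) + 1)) atTop (𝓝 0) :=
    tendsto_one_div_add_atTop_nhds_zero_nat
  have hex n : ∃ q ∈ S n, FiniteKL ν q ∧ kl ν q < J n + 1 / ((n : ℝ) + 1) := by
    obtain ⟨_, ⟨q, ⟨hq, fq⟩, rfl⟩, hlt⟩ :=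
      exists_lt_of_csInf_lt (hne n) (lt_add_of_pos_right (J n) (Nat.one_div_pos_of_nat (n := n)))
    exact ⟨q, hq, fq, hlt⟩
  choose q hqS fq hqJ using hex
  -- For `n ≤ k` the midpoint of `q n` and `q k` lies in `S n`, so its relative entropy is at least
  -- `J n`. The midpoint inequality then gives `2 (J k - J n) + 2 / (n + 1) + 2 / (k + 1)` as a
  -- bound on the squared Hellinger distance.
  obtain ⟨p, ns, hp, hns, hae⟩ := exists_density_of_hellinger_cauchy
    (fun n => hd n _ (hqS n)) (b := fun n => 2 * (L - J n) + 4 * (1 / ((n : ℝ) + 1)))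
    (by simpa using ((hJlim.const_sub L).const_mul 2).add (hone.const_mul 4))
    (fun n k hnk => by
      have h := kl_midpoint (hd n _ (hqS n)) (hd k _ (hqS k)) (fq n) (fq k)
      have hm := hJ n (convex_mid (hS n) (hqS n) (hanti hnk (hqS k)) (t := 1 / 2) (by norm_num)
        (by norm_num)) ((fq n).combo (hd n _ (hqS n)) (hd k _ (hqS k)) (fq k)
          (by norm_num) (by norm_num)).1
      have h1 : 1 / ((k : ℝ) + 1) ≤ 1 / ((n : ℝ) + 1) := by gcongr
      linarith [hqJ n, hqJ k, le_ciSup hJb k])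
  have hpK K' (h : ∀ n, ∃ p ∈ S n, FiniteKL ν p ∧ kl ν p ≤ K') : FiniteKL ν p ∧ kl ν p ≤ K' := by
    refine kl_le_of_tendsto_ae (fun n => hd _ _ (hqS (ns n))) hp (fun n => fq _)
      (b := fun n => K' + 1 / ((ns n : ℝ) + 1)) (fun n => ?_) ?_ hae
    · linarith [hqJ (ns n), hJK K' h (ns n)]
    · simpa using (hone.comp hns.tendsto_atTop).const_add K'
  refine ⟨p, fun n => ?_, (hpK K hK).1, (hpK K hK).2, fun K' h => (hpK K' h).2⟩
  -- Dropping the first `n` terms leaves only indices at least `n`, hence points of `S n`.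
  exact hcl n (fun i => q (ns (i + n))) p
    (fun i => hanti ((Nat.le_add_left n i).trans (hns.id_le _)) (hqS _)) hp
    (hae.mono fun x hx => (tendsto_add_atTop_iff_nat n).2 hx)

theorem exists_isMin_kl {S : Set (Ω → ℝ)} (hS : Convex ℝ S) (hd : ∀ p ∈ S, IsDensity ν p)
    (hcl : IsSeqClosedAE ν S) (hne : ∃ p ∈ S, FiniteKL ν p) :
    ∃ p ∈ S, FiniteKL ν p ∧ ∀ q ∈ S, FiniteKL ν q → kl ν p ≤ kl ν q := by
  obtain ⟨p₀, hp₀, fp₀⟩ := hne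
  obtain ⟨p, hp, fp, -, h⟩ := exists_mem_iInter_kl_le (S := fun _ => S) (fun _ => hS) (fun _ => hd)
    (fun _ => hcl) antitone_const (K := kl ν p₀) fun _ => ⟨p₀, hp₀, fp₀, le_rfl⟩
  exact ⟨p, hp 0, fp, fun q hq fq => h _ fun _ => ⟨q, hq, fq, le_rfl⟩⟩

end Microcanonical

namespace Microcanonical
open InformationTheory

/-! ### The variational inequality at an entropy projection -/

theorem tendsto_klFun_slope_of_pos {x y : ℝ} (hx : 0 < x) :
    Tendsto (fun t : ℝ => (klFun ((1 - t) * x + t * y) - klFun x) / t) (𝓝[>] 0)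
      (𝓝 (Real.log x * (y - x))) := by
  have h1 : HasDerivAt (fun t : ℝ => (1 - t) * x + t * y) (y - x) 0 := by
    have := (((hasDerivAt_id (0 : ℝ)).const_sub 1).mul_const x).add
      ((hasDerivAt_id (0 : ℝ)).mul_const y)
    exact this.congr_deriv (by ring)
  have h2 : HasDerivAt (fun t : ℝ => klFun ((1 - t) * x + t * y)) (Real.log x * (y - x)) 0 := by
    refine HasDerivAt.comp (h₂ := klFun) 0 ?_ h1
    rw [sub_zero, one_mul, zero_mul, add_zero]
    exact hasDerivAt_klFun hx.ne'
  refine h2.tendsto_slope_zero_right.congr fun t => ?_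
  simp [div_eq_inv_mul]

/-- The derivative of `klFun` at 0 is `-∞`. This forces other points of the convex set to vanish
where the minimizer does. -/
theorem tendsto_klFun_slope_zero {y : ℝ} (hy : 0 < y) :
    Tendsto (fun t : ℝ => (klFun ((1 - t) * 0 + t * y) - klFun 0) / t) (𝓝[>] 0) atBot := by
  have h : Tendsto (fun t : ℝ => y * (Real.log y + Real.log t) - y) (𝓝[>] 0) atBot :=
    tendsto_atBot_add_const_right _ _
      ((tendsto_atBot_add_const_left _ _ Real.tendsto_log_nhdsGT_zero).const_mul_atBot hy)
  refine h.congr' ?_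
  filter_upwards [self_mem_nhdsWithin] with t ht
  have ht : 0 < t := ht
  rw [klFun_zero, klFun_apply, mul_zero, zero_add, Real.log_mul ht.ne' hy.ne']
  field_simp
  ring

theorem klFun_bregman_nonneg {x y : ℝ} (hx : 0 ≤ x) (hy : 0 ≤ y) (h : x = 0 → y = 0) :
    0 ≤ klFun y - klFun x - Real.log x * (y - x) := by
  rcases hx.eq_or_lt with rfl | hx
  · simp [h rfl]
  · exact (sq_nonneg _).trans (bregman_ge_hellinger hy hx)

variable {Ω : Type*} [MeasurableSpace Ω] {ν : Measure Ω} {p q : Ω → ℝ}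

theorem mul_log_eq_klFun (x : ℝ) : x * Real.log x = klFun x - 1 + x := by
  rw [klFun_apply]; ring

theorem integrable_mul_log [IsProbabilityMeasure ν] (hp : IsDensity ν p) (fp : FiniteKL ν p) :
    Integrable (fun x => p x * Real.log (p x)) ν ∧ ∫ x, p x * Real.log (p x) ∂ν = kl ν p := by
  have hi : Integrable (fun x => klFun (p x) - 1) ν := Integrable.sub fp (integrable_const 1)
  simp_rw [mul_log_eq_klFun]
  refine ⟨hi.add hp.integrable, ?_⟩
  rw [integral_add hi hp.integrable, integral_sub fp (integrable_const 1), hp.integral_eq_one]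
  simp [kl]

/-- The variational inequality characterizing the entropy projection on a convex set. -/
theorem kl_le_integral_mul_log [IsProbabilityMeasure ν] {S : Set (Ω → ℝ)} (hS : Convex ℝ S)
    (hd : ∀ p ∈ S, IsDensity ν p) (hp : p ∈ S) (fp : FiniteKL ν p)
    (hmin : ∀ q ∈ S, FiniteKL ν q → kl ν p ≤ kl ν q) (hq : q ∈ S) (fq : FiniteKL ν q) :
    (∀ᵐ x ∂ν, p x = 0 → q x = 0) ∧ Integrable (fun x => q x * Real.log (p x)) ν ∧
      kl ν p ≤ ∫ x, q x * Real.log (p x) ∂ν := by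
  have dp := hd p hp
  have dq := hd q hq
  let t (n : ℕ) : ℝ := 1 / ((n : ℝ) + 1)
  have ht0 n : 0 < t n := Nat.one_div_pos_of_nat
  have ht1 n : t n ≤ 1 := by
    rw [div_le_one (by positivity)]
    linarith [n.cast_nonneg (α := ℝ)]
  have htlim : Tendsto t atTop (𝓝[>] 0) := tendsto_nhdsWithin_iff.2
    ⟨tendsto_one_div_add_atTop_nhds_zero_nat, .of_forall ht0⟩
  let R (n : ℕ) (x : Ω) : ℝ := (1 - t n) * p x + t n * q x
  -- `G n` compares the chord slope of `klFun` from `p` to `q` with the slope at step `t n`: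
  -- nonnegative by convexity, and of integral at most `kl q - kl p` by minimality. Fatou's lemma as
  -- `t n → 0` yields the inequality.
  let G (n : ℕ) (x : Ω) : ℝ := klFun (q x) - klFun (p x) - (klFun (R n x) - klFun (p x)) / t n
  have dR n : IsDensity ν (R n) := dp.combo dq (ht0 n).le (ht1 n)
  have fR n : FiniteKL ν (R n) := (fp.combo dp dq fq (ht0 n).le (ht1 n)).1
  have hRmin n : kl ν p ≤ kl ν (R n) := hmin _ (convex_mid hS hp hq (ht0 n).le (ht1 n)) (fR n)
  have hG0 n x : 0 ≤ G n x := by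
    have := klFun_combo_le (dp.nonneg x) (dq.nonneg x) (ht0 n).le (ht1 n)
    rw [sub_nonneg, div_le_iff₀ (ht0 n)]
    linarith
  have hi1 : Integrable (fun x => klFun (q x) - klFun (p x)) ν := Integrable.sub fq fp
  have hi2 n : Integrable (fun x => (klFun (R n x) - klFun (p x)) / t n) ν :=
    (Integrable.sub (fR n) fp).div_const _
  have hGi n : Integrable (G n) ν := hi1.sub (hi2 n)
  have hGm n : Measurable (G n) := (dq.measurable_klFun.sub dp.measurable_klFun).sub
    (((dR n).measurable_klFun.sub dp.measurable_klFun).div_const _)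
  have hGint n : ∫ x, G n x ∂ν ≤ kl ν q - kl ν p := by
    rw [integral_sub hi1 (hi2 n), integral_sub fq fp, integral_div, integral_sub (fR n) fp]
    have : 0 ≤ (kl ν (R n) - kl ν p) / t n := div_nonneg (sub_nonneg.2 (hRmin n)) (ht0 n).le
    simp only [kl] at this ⊢
    linarith
  have hfatou : ∫⁻ x, liminf (fun n => ENNReal.ofReal (G n x)) atTop ∂ν ≤
      ENNReal.ofReal (kl ν q - kl ν p) := by
    refine (lintegral_liminf_le fun n => (hGm n).ennreal_ofReal).trans ?_
    refine (liminf_le_liminf (v := fun _ => ENNReal.ofReal (kl ν q - kl ν p))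
      (.of_forall fun n => ?_)).trans (by simp)
    rw [← ofReal_integral_eq_lintegral_ofReal (hGi n) (.of_forall (hG0 n))]
    exact ENNReal.ofReal_le_ofReal (hGint n)
  -- Where `p = 0 < q` the functions `G n` tend to infinity, so this set is null.
  have hac : ∀ᵐ x ∂ν, p x = 0 → q x = 0 := by
    have := ae_lt_top (Measurable.liminf fun n => (hGm n).ennreal_ofReal)
      (hfatou.trans_lt ENNReal.ofReal_lt_top).ne
    filter_upwards [this] with x hx hpx
    by_contra hqx
    have hqx : 0 < q x := (dq.nonneg x).lt_of_ne' hqx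
    refine hx.ne (Tendsto.liminf_eq ?_)
    refine ENNReal.tendsto_ofReal_nhds_top.2 ?_
    have h := (tendsto_klFun_slope_zero hqx).comp htlim
    have h2 := tendsto_atTop_add_const_left atTop (klFun (q x) - klFun (p x))
      (tendsto_neg_atBot_atTop.comp h)
    refine h2.congr fun n => ?_
    simp only [G, R, hpx, Function.comp]
    ring
  -- The pointwise limit of `G n`. At zeros of `p` the convention `log 0 = 0` gives the right value
  -- 0, since `q` vanishes there too.
  let B (x : Ω) : ℝ := klFun (q x) - klFun (p x) - Real.log (p x) * (q x - p x)
  have hB0 : ∀ᵐ x ∂ν, 0 ≤ B x :=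
    hac.mono fun x hx => klFun_bregman_nonneg (dp.nonneg x) (dq.nonneg x) hx
  have hBlim : ∀ᵐ x ∂ν, liminf (fun n => ENNReal.ofReal (G n x)) atTop = ENNReal.ofReal (B x) := by
    filter_upwards [hac] with x hx
    refine Tendsto.liminf_eq ((ENNReal.continuous_ofReal.tendsto _).comp ?_)
    rcases (dp.nonneg x).eq_or_lt with h0 | hpos
    · have hq0 := hx h0.symm
      simp [B, G, R, ← h0, hq0]
    · exact ((tendsto_klFun_slope_of_pos hpos).comp htlim).const_sub _
  have hBm : Measurable B := (dq.measurable_klFun.sub dp.measurable_klFun).sub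
    (dp.measurable.log.mul (dq.measurable.sub dp.measurable))
  rw [lintegral_congr_ae hBlim] at hfatou
  have hBi : Integrable B ν := by
    refine ⟨hBm.aestronglyMeasurable, ?_⟩
    rw [hasFiniteIntegral_iff_ofReal hB0]
    exact hfatou.trans_lt ENNReal.ofReal_lt_top
  have hBle : ∫ x, B x ∂ν ≤ kl ν q - kl ν p := by
    rw [← ofReal_integral_eq_lintegral_ofReal hBi hB0] at hfatou
    refine (ENNReal.ofReal_le_ofReal_iff ?_).1 hfatou
    exact sub_nonneg.2 (hmin q hq fq)
  obtain ⟨hpl, hple⟩ := integrable_mul_log dp fp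
  have e : (fun x => q x * Real.log (p x)) =
      fun x => klFun (q x) - klFun (p x) - B x + p x * Real.log (p x) := by
    ext x
    simp only [B]
    ring
  have hi3 : Integrable (fun x => klFun (q x) - klFun (p x) - B x) ν := hi1.sub hBi
  rw [e]
  refine ⟨hac, hi3.add hpl, ?_⟩
  rw [integral_add hi3 hpl, integral_sub hi1 hBi, integral_sub fq fp, hple]
  simp only [kl] at hBle ⊢
  linarith

/-! ### Densities with prescribed moments -/

variable {m : ℕ}

/-- The densities whose moments agree with `a` up to `δ`, with only an upper bound on the moment of
the last observable. -/
def feasible (ν : Measure Ω) (ψ : Fin (m + 1) → Ω → ℝ) (a : Fin (m + 1) → ℝ) (δ : ℝ) :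
    Set (Ω → ℝ) :=
  {p | IsDensity ν p ∧ (∀ i, Integrable (fun x => p x * ψ i x) ν) ∧
    (∀ i : Fin m, |∫ x, p x * ψ i.castSucc x ∂ν - a i.castSucc| ≤ δ) ∧
    ∫ x, p x * ψ (Fin.last m) x ∂ν ≤ a (Fin.last m) + δ}

/-- The last observable dominates the others. -/
structure Dominated (ψ : Fin (m + 1) → Ω → ℝ) : Prop where
  measurable : ∀ i, Measurable (ψ i)
  nonneg : ∀ i x, 0 ≤ ψ i x
  le : ∀ i : Fin m, ∀ ε : ℝ, 0 < ε → ∃ K : ℝ, ∀ x, ψ i.castSucc x ≤ ε * ψ (Fin.last m) x + K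

variable {ψ : Fin (m + 1) → Ω → ℝ} {a : Fin (m + 1) → ℝ} {δ : ℝ}

theorem integral_combo {f : Ω → ℝ} (hp : Integrable (fun x => p x * f x) ν)
    (hq : Integrable (fun x => q x * f x) ν) (s t : ℝ) :
    Integrable (fun x => (s * p x + t * q x) * f x) ν ∧
    ∫ x, (s * p x + t * q x) * f x ∂ν = s * ∫ x, p x * f x ∂ν + t * ∫ x, q x * f x ∂ν := by
  have e : (fun x => (s * p x + t * q x) * f x) =
      fun x => s * (p x * f x) + t * (q x * f x) := by ext x; ring
  rw [e]
  refine ⟨(hp.const_mul s).add (hq.const_mul t), ?_⟩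
  rw [integral_add (hp.const_mul s) (hq.const_mul t), integral_const_mul, integral_const_mul]

theorem convex_feasible : Convex ℝ (feasible ν ψ a δ) := by
  intro p hp q hq s t hs ht hst
  obtain rfl : s = 1 - t := by linarith
  refine ⟨hp.1.combo hq.1 ht (by linarith), fun i => (integral_combo (hp.2.1 i) (hq.2.1 i) _ _).1,
    fun i => ?_, ?_⟩
  · have := (integral_combo (hp.2.1 i.castSucc) (hq.2.1 i.castSucc) (1 - t) t).2
    change |∫ x, ((1 - t) * p x + t * q x) * ψ i.castSucc x ∂ν - _| ≤ δ
    rw [this]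
    have h1 := abs_le.1 (hp.2.2.1 i)
    have h2 := abs_le.1 (hq.2.2.1 i)
    rw [abs_le]
    constructor <;> nlinarith
  · have := (integral_combo (hp.2.1 (Fin.last m)) (hq.2.1 (Fin.last m)) (1 - t) t).2
    change ∫ x, ((1 - t) * p x + t * q x) * ψ (Fin.last m) x ∂ν ≤ _
    rw [this]
    nlinarith [hp.2.2.2, hq.2.2.2]

/-- Fatou's lemma: upper bounds on integrals of nonnegative functions survive almost everywhere
limits. -/
theorem integral_le_of_tendsto_ae {u : ℕ → Ω → ℝ} {f : Ω → ℝ} (hu : ∀ n, Integrable (u n) ν)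
    (hu0 : ∀ n x, 0 ≤ u n x) (hf : Measurable f) (hf0 : ∀ x, 0 ≤ f x) {A : ℝ}
    (hA : ∀ n, ∫ x, u n x ∂ν ≤ A) (h : ∀ᵐ x ∂ν, Tendsto (fun n => u n x) atTop (𝓝 (f x))) :
    Integrable f ν ∧ ∫ x, f x ∂ν ≤ A := by
  have hA0 : 0 ≤ A := (integral_nonneg (hu0 0)).trans (hA 0)
  have hle : ∫⁻ x, ENNReal.ofReal (f x) ∂ν ≤ ENNReal.ofReal A := by
    calc ∫⁻ x, ENNReal.ofReal (f x) ∂ν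
        = ∫⁻ x, liminf (fun n => ENNReal.ofReal (u n x)) atTop ∂ν :=
          lintegral_congr_ae (h.mono fun x hx =>
            ((ENNReal.continuous_ofReal.tendsto _).comp hx).liminf_eq.symm)
      _ ≤ liminf (fun n => ∫⁻ x, ENNReal.ofReal (u n x) ∂ν) atTop :=
          lintegral_liminf_le' fun n => (hu n).aestronglyMeasurable.aemeasurable.ennreal_ofReal
      _ ≤ liminf (fun _ => ENNReal.ofReal A) atTop := by
          refine liminf_le_liminf (.of_forall fun n => ?_)
          rw [← ofReal_integral_eq_lintegral_ofReal (hu n) (.of_forall (hu0 n))]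
          exact ENNReal.ofReal_le_ofReal (hA n)
      _ = ENNReal.ofReal A := by simp
  have hfi : Integrable f ν := by
    refine ⟨hf.aestronglyMeasurable, ?_⟩
    rw [hasFiniteIntegral_iff_ofReal (.of_forall hf0)]
    exact hle.trans_lt ENNReal.ofReal_lt_top
  refine ⟨hfi, ?_⟩
  rw [← ofReal_integral_eq_lintegral_ofReal hfi (.of_forall hf0)] at hle
  exact (ENNReal.ofReal_le_ofReal_iff hA0).1 hle

theorem isSeqClosedAE_feasible (hψ : Dominated ψ) : IsSeqClosedAE ν (feasible ν ψ a δ) := by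
  intro u p hu hp hlim
  have hlim' (f : Ω → ℝ) : ∀ᵐ x ∂ν, Tendsto (fun n => u n x * f x) atTop (𝓝 (p x * f x)) :=
    hlim.mono fun x hx => hx.mul_const _
  have hup i A (hA : ∀ n, ∫ x, u n x * ψ i x ∂ν ≤ A) :
      Integrable (fun x => p x * ψ i x) ν ∧ ∫ x, p x * ψ i x ∂ν ≤ A :=
    integral_le_of_tendsto_ae (fun n => (hu n).2.1 i)
      (fun n x => mul_nonneg ((hu n).1.nonneg x) (hψ.nonneg i x))
      (hp.measurable.mul (hψ.measurable i))
      (fun x => mul_nonneg (hp.nonneg x) (hψ.nonneg i x)) hA (hlim' _)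
  have hub i n : ∫ x, u n x * ψ (Fin.castSucc i) x ∂ν ≤ a i.castSucc + δ := by
    linarith [(abs_le.1 ((hu n).2.2.1 i)).2]
  have hlast := hup (Fin.last m) _ fun n => (hu n).2.2.2
  refine ⟨hp, fun i => ?_, fun i => ?_, hlast.2⟩
  · induction i using Fin.lastCases with
    | last => exact hlast.1
    | cast i => exact (hup i.castSucc _ (hub i)).1
  have hi := hup i.castSucc _ (hub i)
  rw [abs_le]
  refine ⟨?_, by linarith⟩
  set A := a (Fin.last m) + δ
  have hA0 : 0 ≤ A :=
    (integral_nonneg fun x => mul_nonneg ((hu 0).1.nonneg x) (hψ.nonneg _ x)).trans (hu 0).2.2.2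
  -- The lower bound is an upper bound for the nonnegative function `ε ψ_k + K - ψ_i`, to which
  -- Fatou's lemma applies; the price `ε * A` vanishes with `ε`.
  have key ε (hε : 0 < ε) : a i.castSucc - δ ≤ ∫ x, p x * ψ i.castSucc x ∂ν + ε * A := by
    obtain ⟨K, hK⟩ := hψ.le i ε hε
    let g x := ε * ψ (Fin.last m) x + K - ψ i.castSucc x
    have hg0 x : 0 ≤ g x := sub_nonneg.2 (hK x)
    have hgm : Measurable g :=
      (((hψ.measurable _).const_mul ε).add_const K).sub (hψ.measurable _)
    have hint r (hr : IsDensity ν r) (h1 : Integrable (fun x => r x * ψ (Fin.last m) x) ν)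
        (h2 : Integrable (fun x => r x * ψ i.castSucc x) ν) :
        Integrable (fun x => r x * g x) ν ∧ ∫ x, r x * g x ∂ν =
          ε * ∫ x, r x * ψ (Fin.last m) x ∂ν + K - ∫ x, r x * ψ i.castSucc x ∂ν := by
      have e : (fun x => r x * g x) = fun x =>
          ε * (r x * ψ (Fin.last m) x) + K * r x - r x * ψ i.castSucc x := by
        ext x; simp only [g]; ring
      have h3 : Integrable (fun x => ε * (r x * ψ (Fin.last m) x) + K * r x) ν :=
        (h1.const_mul ε).add (hr.integrable.const_mul K)
      rw [e]
      refine ⟨h3.sub h2, ?_⟩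
      rw [integral_sub h3 h2, integral_add (h1.const_mul ε) (hr.integrable.const_mul K),
        integral_const_mul, integral_const_mul, hr.integral_eq_one, mul_one]
    have h := integral_le_of_tendsto_ae (f := fun x => p x * g x)
      (fun n => (hint _ (hu n).1 ((hu n).2.1 _) ((hu n).2.1 _)).1)
      (fun n x => mul_nonneg ((hu n).1.nonneg x) (hg0 x)) (hp.measurable.mul hgm)
      (fun x => mul_nonneg (hp.nonneg x) (hg0 x)) (A := ε * A + K - (a i.castSucc - δ))
      (fun n => by
        rw [(hint _ (hu n).1 ((hu n).2.1 _) ((hu n).2.1 _)).2]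
        nlinarith [(hu n).2.2.2, (abs_le.1 ((hu n).2.2.1 i)).1]) (hlim' g)
    rw [(hint p hp hlast.1 hi.1).2] at h
    have : 0 ≤ ε * ∫ x, p x * ψ (Fin.last m) x ∂ν :=
      mul_nonneg hε.le (integral_nonneg fun x => mul_nonneg (hp.nonneg x) (hψ.nonneg _ x))
    linarith [h.2]
  have hle : a i.castSucc - δ ≤ ∫ x, p x * ψ i.castSucc x ∂ν := by
    refine le_of_forall_pos_le_add fun ε hε => ?_
    have := key (ε / (A + 1)) (by positivity)
    have h2 : ε / (A + 1) * A ≤ ε := by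
      rw [div_mul_eq_mul_div, div_le_iff₀ (by positivity)]
      nlinarith
    linarith
  linarith

theorem feasible_mono {δ' : ℝ} (h : δ ≤ δ') : feasible ν ψ a δ ⊆ feasible ν ψ a δ' :=
  fun _ hp => ⟨hp.1, hp.2.1, fun i => (hp.2.2.1 i).trans h, hp.2.2.2.trans (by linarith)⟩

theorem exists_feasible_isMin (hψ : Dominated ψ) (hne : ∃ p ∈ feasible ν ψ a δ, FiniteKL ν p) :
    ∃ p ∈ feasible ν ψ a δ, FiniteKL ν p ∧
      ∀ q ∈ feasible ν ψ a δ, FiniteKL ν q → kl ν p ≤ kl ν q :=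
  exists_isMin_kl convex_feasible (fun _ hp => hp.1) (isSeqClosedAE_feasible hψ) hne

/-- The minimal relative entropy over the `δ`-relaxed constraints is continuous at `δ = 0`. -/
theorem exists_forall_lt_kl (hψ : Dominated ψ) 
    (hmin : ∀ q ∈ feasible ν ψ a 0, FiniteKL ν q → kl ν p ≤ kl ν q) {ε : ℝ} (hε : 0 < ε) :
    ∃ δ₀ > 0, ∀ δ, δ ≤ δ₀ → ∀ q ∈ feasible ν ψ a δ, FiniteKL ν q → kl ν p - ε < kl ν q := by
  by_contra! hcon
  have hpos (n : ℕ) : (0 : ℝ) < 1 / ((n : ℝ) + 1) := Nat.one_div_pos_of_nat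
  -- Counterexamples at every tolerance would produce a point common to all relaxed sets, hence
  -- feasible at tolerance 0, that beats the minimum.
  obtain ⟨r, hr, fr, hrK, -⟩ := exists_mem_iInter_kl_le
    (S := fun n : ℕ => feasible ν ψ a (1 / ((n : ℝ) + 1))) (fun _ => convex_feasible)
    (fun _ _ h => h.1) (fun _ => isSeqClosedAE_feasible hψ)
    (fun i j hij => feasible_mono (by gcongr)) (K := kl ν p - ε) fun n => by
      obtain ⟨δ, hδ, q, hq, fq, hk⟩ := hcon _ (hpos n)
      exact ⟨q, feasible_mono hδ hq, fq, hk⟩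
  have hlim := tendsto_one_div_add_atTop_nhds_zero_nat (𝕜 := ℝ)
  have hr0 : r ∈ feasible ν ψ a 0 :=
    ⟨(hr 0).1, (hr 0).2.1, fun i => ge_of_tendsto' hlim fun n => (hr n).2.2.1 i,
      ge_of_tendsto' (hlim.const_add _) fun n => (hr n).2.2.2⟩
  linarith [hmin r hr0 fr]

end Microcanonical

namespace Microcanonical
open InformationTheory

variable {Ω : Type*} [MeasurableSpace Ω] {ν : Measure Ω} {p q : Ω → ℝ}

/-! ### Densities and laws -/

/-- The law with density `p`. -/
def withDens (ν : Measure Ω) (p : Ω → ℝ) : Measure Ω := ν.withDensity fun x => ENNReal.ofReal (p x)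

theorem IsDensity.isProbabilityMeasure (hp : IsDensity ν p) :
    IsProbabilityMeasure (withDens ν p) := by
  refine ⟨?_⟩
  rw [withDens, withDensity_apply _ .univ, Measure.restrict_univ,
    ← ofReal_integral_eq_lintegral_ofReal hp.integrable (.of_forall hp.nonneg),
    hp.integral_eq_one, ENNReal.ofReal_one]

theorem integral_withDens (hp : IsDensity ν p) (f : Ω → ℝ) :
    ∫ x, f x ∂(withDens ν p) = ∫ x, p x * f x ∂ν := by
  rw [withDens, integral_withDensity_eq_integral_toReal_smul hp.measurable.ennreal_ofReal
    (.of_forall fun _ => ENNReal.ofReal_lt_top)]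
  simp [ENNReal.toReal_ofReal (hp.nonneg _)]

theorem integrable_withDens_iff (hp : IsDensity ν p) (f : Ω → ℝ) :
    Integrable f (withDens ν p) ↔ Integrable (fun x => p x * f x) ν := by
  rw [withDens, integrable_withDensity_iff_integrable_smul' hp.measurable.ennreal_ofReal
    (.of_forall fun _ => ENNReal.ofReal_lt_top)]
  simp [ENNReal.toReal_ofReal (hp.nonneg _)]

/-- The density of `μ` with respect to `ν`. -/
def dens (ν μ : Measure Ω) (x : Ω) : ℝ := (μ.rnDeriv ν x).toReal

section dens

variable {μ : Measure Ω} [IsProbabilityMeasure μ] [IsProbabilityMeasure ν]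

theorem integrable_dens_mul_iff (h : μ ≪ ν) {f : Ω → ℝ} :
    Integrable (fun x => dens ν μ x * f x) ν ↔ Integrable f μ :=
  integrable_rnDeriv_smul_iff h

theorem integral_dens_mul (h : μ ≪ ν) (f : Ω → ℝ) :
    ∫ x, dens ν μ x * f x ∂ν = ∫ x, f x ∂μ :=
  integral_rnDeriv_smul h

theorem isDensity_dens (h : μ ≪ ν) : IsDensity ν (dens ν μ) where
  measurable := (Measure.measurable_rnDeriv μ ν).ennreal_toReal
  nonneg _ := ENNReal.toReal_nonneg
  integrable := Measure.integrable_toReal_rnDeriv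
  integral_eq_one := by simpa using integral_dens_mul h fun _ => 1

theorem withDens_dens (h : μ ≪ ν) : withDens ν (dens ν μ) = μ := by
  conv_rhs => rw [← Measure.withDensity_rnDeriv_eq μ ν h]
  refine withDensity_congr_ae ?_
  filter_upwards [Measure.rnDeriv_lt_top μ ν] with x hx
  exact ENNReal.ofReal_toReal hx.ne

/-- A bounded density has finite relative entropy under a probability measure. Only finiteness is
needed, so the bound may grow with `n` for conditional laws. -/
theorem finiteKL_dens_of_le_smul (h : μ ≪ ν) {c : NNReal} (hc : μ ≤ c • ν) :
    FiniteKL ν (dens ν μ) := by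
  have hle : ∀ᵐ x ∂ν, μ.rnDeriv ν x ≤ c := by
    refine ae_le_of_forall_setLIntegral_le_of_sigmaFinite (Measure.measurable_rnDeriv μ ν)
      fun s _ _ => ?_
    refine (Measure.setLIntegral_rnDeriv_le s).trans ((hc s).trans ?_)
    simp
  have hd := isDensity_dens h
  refine (integrable_const (1 + (c : ℝ) ^ 2)).mono' hd.measurable_klFun.aestronglyMeasurable ?_
  filter_upwards [hle] with x hx
  rw [Real.norm_of_nonneg (hd.klFun_nonneg x)]
  have h0 : 0 ≤ dens ν μ x := hd.nonneg x
  have h1 : dens ν μ x ≤ c := ENNReal.toReal_le_coe_of_le_coe hx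
  have h2 : Real.log (dens ν μ x) ≤ dens ν μ x := Real.log_le_self h0
  rw [klFun_apply]
  nlinarith [mul_le_mul_of_nonneg_left h2 h0, mul_self_le_mul_self h0 h1]

end dens

/-! ### Change of measure on the configuration space -/

variable [IsProbabilityMeasure ν]

/-- The law of a configuration with independent coordinates of law `ν`. -/
abbrev prodLaw (ν : Measure Ω) : Measure (ℕ → Ω) := Measure.infinitePi fun _ : ℕ => ν

theorem isProbabilityMeasure_ite (hp : IsDensity ν p) (n : ℕ) (l : ℕ) :
    IsProbabilityMeasure (if l < n then withDens ν p else ν) := by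
  split_ifs
  · exact hp.isProbabilityMeasure
  · infer_instance

theorem withDensity_prod_eq_infinitePi (hp : IsDensity ν p) (n : ℕ) :
    (prodLaw ν).withDensity (fun ω => ∏ l ∈ Finset.range n, ENNReal.ofReal (p (ω l))) =
      Measure.infinitePi fun l => if l < n then withDens ν p else ν := by
  classical
  have := isProbabilityMeasure_ite hp n
  have := hp.isProbabilityMeasure
  refine Measure.eq_infinitePi _ fun s t ht => ?_
  -- Padding the weight and the cylinder indicator by 1 turns both into products over `range n ∪ s`,
  -- to which independence applies coordinate by coordinate.
  let w (l : ℕ) (x : Ω) : ENNReal := if l < n then ENNReal.ofReal (p x) else 1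
  let c (l : ℕ) (x : Ω) : ENNReal := if l ∈ s then (t l).indicator 1 x else 1
  have hw l : Measurable (w l) := by
    by_cases h : l < n
    · simpa [w, h] using hp.measurable.ennreal_ofReal
    · simp [w, h]
  have hc l : Measurable (c l) := by
    by_cases h : l ∈ s
    · simpa [c, h] using measurable_one.indicator (ht l)
    · simp [c, h]
  have hwν l : ν.withDensity (w l) = if l < n then withDens ν p else ν := by
    split_ifs with h
    · simp [w, h, withDens]
    · simp [w, h]
  have hm l : ∫⁻ x, w l x * c l x ∂ν =
      if l ∈ s then (if l < n then withDens ν p else ν) (t l) else 1 := by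
    rw [← hwν l]
    by_cases h : l ∈ s
    · rw [if_pos h, withDensity_apply _ (ht l), ← lintegral_indicator (ht l)]
      refine lintegral_congr fun x => ?_
      by_cases hx : x ∈ t l <;> simp [c, h, hx]
    · simp only [c, h, if_false, mul_one]
      have := isProbabilityMeasure_ite hp n l
      rw [← hwν l] at this
      rw [← setLIntegral_univ, ← withDensity_apply _ .univ, this.measure_univ]
  have hpi : MeasurableSet (Set.pi (s : Set ℕ) t) :=
    MeasurableSet.pi s.countable_toSet fun i _ => ht i
  rw [withDensity_apply _ hpi, ← lintegral_indicator hpi]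
  have he ω : (Set.pi (s : Set ℕ) t).indicator
      (fun ω => ∏ l ∈ Finset.range n, ENNReal.ofReal (p (ω l))) ω =
      ∏ l ∈ Finset.range n ∪ s, w l (ω l) * c l (ω l) := by
    rw [Finset.prod_mul_distrib]
    have h1 : ∏ l ∈ Finset.range n ∪ s, w l (ω l) =
        ∏ l ∈ Finset.range n, ENNReal.ofReal (p (ω l)) := by
      rw [← Finset.prod_subset Finset.subset_union_left]
      · exact Finset.prod_congr rfl fun l hl => if_pos (Finset.mem_range.1 hl)
      · exact fun l _ hl => if_neg fun h => hl (Finset.mem_range.2 h)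
    have h2 : ∏ l ∈ Finset.range n ∪ s, c l (ω l) = ∏ l ∈ s, (t l).indicator 1 (ω l) := by
      rw [← Finset.prod_subset Finset.subset_union_right]
      · exact Finset.prod_congr rfl fun l hl => if_pos hl
      · exact fun l _ hl => if_neg hl
    rw [h1, h2]
    by_cases hω : ω ∈ Set.pi (s : Set ℕ) t
    · rw [Set.indicator_of_mem hω, Finset.prod_eq_one (s := s), mul_one]
      exact fun l hl => Set.indicator_of_mem (hω l hl) _
    · rw [Set.indicator_of_notMem hω]
      simp only [Set.mem_pi, not_forall] at hω
      obtain ⟨l, hl, hlt⟩ := hω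
      rw [Finset.prod_eq_zero (i := l) (s := s) hl (Set.indicator_of_notMem hlt _), mul_zero]
  simp_rw [he]
  have hind : iIndepFun (fun l (ω : ℕ → Ω) => w l (ω l) * c l (ω l)) (prodLaw ν) :=
    iIndepFun_infinitePi (X := fun l x => w l x * c l x) fun l => (hw l).mul (hc l)
  rw [lintegral_prod_eq_prod_lintegral_of_indepFun _
    (fun l (ω : ℕ → Ω) => w l (ω l) * c l (ω l)) hind
    fun l => ((hw l).mul (hc l)).comp (measurable_pi_apply l)]
  have hl l : ∫⁻ ω : ℕ → Ω, w l (ω l) * c l (ω l) ∂(prodLaw ν) = ∫⁻ x, w l x * c l x ∂ν :=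
    (measurePreserving_eval_infinitePi (fun _ : ℕ => ν) l).lintegral_comp ((hw l).mul (hc l))
  simp_rw [hl, hm]
  rw [← Finset.prod_subset Finset.subset_union_right fun l _ hl => if_neg hl]
  exact Finset.prod_congr rfl fun l hl => if_pos hl

theorem exists_measurable_factor {α β : Type*} [MeasurableSpace α] [MeasurableSpace β] [Nonempty α]
    {n : ℕ} {G : (ℕ → α) → β} (hG : Measurable G) (hdep : DependsOn G (Set.Iio n)) :
    ∃ G' : (Fin n → α) → β, Measurable G' ∧ ∀ ω, G ω = G' fun i => ω i := by
  obtain ⟨x₀⟩ := ‹Nonempty α›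
  -- The coordinates that `G` ignores are filled in with a fixed point.
  let ext (x : Fin n → α) (l : ℕ) : α := if h : l < n then x ⟨l, h⟩ else x₀
  have hext : Measurable ext := measurable_pi_iff.2 fun l => by
    by_cases h : l < n
    · simpa [ext, h] using measurable_pi_apply _
    · simp [ext, h]
  exact ⟨fun x => G (ext x), hG.comp hext, fun ω => hdep fun l hl => by simp [ext, Set.mem_Iio.1 hl]⟩

/-- Change of measure for functions of the first `n` coordinates. -/
theorem lintegral_prod_mul_eq (hp : IsDensity ν p) (n : ℕ) {G : (ℕ → Ω) → ENNReal}
    (hG : Measurable G) (hdep : DependsOn G (Set.Iio n)) :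
    ∫⁻ ω, (∏ l ∈ Finset.range n, ENNReal.ofReal (p (ω l))) * G ω ∂(prodLaw ν) =
      ∫⁻ ω, G ω ∂(prodLaw (withDens ν p)) := by
  classical
  have := isProbabilityMeasure_ite hp n
  have := hp.isProbabilityMeasure
  have : Nonempty Ω := nonempty_of_isProbabilityMeasure ν
  obtain ⟨G', hG', hGe⟩ := exists_measurable_factor hG hdep
  have hr : Measurable fun (ω : ℕ → Ω) (i : Fin n) => ω i :=
    measurable_pi_iff.2 fun i => measurable_pi_apply _
  have hmeas : Measurable fun ω : ℕ → Ω => ∏ l ∈ Finset.range n, ENNReal.ofReal (p (ω l)) :=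
    Finset.measurable_prod _ fun l _ => (hp.measurable.comp (measurable_pi_apply l)).ennreal_ofReal
  have h1 := lintegral_withDensity_eq_lintegral_mul (prodLaw ν) hmeas hG
  simp only [Pi.mul_apply] at h1
  rw [← h1, withDensity_prod_eq_infinitePi hp n]
  have hmap (P : Measure (ℕ → Ω)) : ∫⁻ ω, G ω ∂P =
      ∫⁻ x, G' x ∂(P.map fun (ω : ℕ → Ω) (i : Fin n) => ω i) := by
    rw [lintegral_map hG' hr]
    exact lintegral_congr hGe
  rw [hmap, hmap]
  congr 1
  rw [Measure.map_infinitePi_infinitePi_of_inj (f := fun i : Fin n => (i : ℕ)) Fin.val_injective,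
    Measure.map_infinitePi_infinitePi_of_inj (f := fun i : Fin n => (i : ℕ)) Fin.val_injective]
  simp

/-! ### Blocks of coordinates -/

/-- The block of index `b` among the consecutive blocks of length `j`. -/
def block (j b : ℕ) (ω : ℕ → Ω) (i : Fin j) : Ω := ω (b * j + i)

theorem measurable_block (j b : ℕ) : Measurable (block (Ω := Ω) j b) :=
  measurable_pi_iff.2 fun _ => measurable_pi_apply _

theorem block_lt {j b N n : ℕ} (hb : b < N) (hN : N * j ≤ n) (i : Fin j) : b * j + i < n := by
  have := Nat.mul_le_mul_right j (Nat.succ_le_of_lt hb)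
  have h2 := i.isLt
  rw [Nat.succ_mul] at this
  omega

/-- Division with remainder by `j` reindexes the coordinates injectively by `ℕ × Fin j`; currying
then gives i.i.d. blocks. -/
theorem map_blocks (j : ℕ) :
    (prodLaw ν).map (fun ω b => block j b ω) =
      Measure.infinitePi fun _ : ℕ => Measure.pi fun _ : Fin j => ν := by
  have hinj : Function.Injective fun x : ℕ × Fin j => x.1 * j + (x.2 : ℕ) := by
    rintro ⟨b, i⟩ ⟨b', i'⟩ h
    have : NeZero j := ⟨(Nat.zero_lt_of_lt i.isLt).ne'⟩
    exact (Nat.divModEquiv j).symm.injective h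
  have h1 := Measure.map_infinitePi_infinitePi_of_inj (P := fun _ : ℕ => ν) hinj
  have h2 := Measure.infinitePi_map_curry (fun (_ : ℕ) (_ : Fin j) => ν)
  have hm : Measurable fun (ω : ℕ → Ω) (x : ℕ × Fin j) => ω (x.1 * j + x.2) :=
    measurable_pi_iff.2 fun _ => measurable_pi_apply _
  rw [← h1, Measure.map_map (MeasurableEquiv.measurable _) hm] at h2
  simp_rw [Measure.infinitePi_eq_pi] at h2
  exact h2

theorem lintegral_prod_block (j N : ℕ) {g : (Fin j → Ω) → ENNReal} (hg : Measurable g) :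
    ∫⁻ ω, ∏ b ∈ Finset.range N, g (block j b ω) ∂(prodLaw ν) =
      (∫⁻ x, g x ∂(Measure.pi fun _ : Fin j => ν)) ^ N := by
  let G (η : ℕ → Fin j → Ω) : ENNReal := ∏ b ∈ Finset.range N, g (η b)
  have hG : Measurable G :=
    Finset.measurable_prod _ fun b _ => hg.comp (measurable_pi_apply b)
  have h1 := lintegral_map (μ := prodLaw ν) hG (g := fun ω b => block j b ω)
    (measurable_pi_iff.2 fun b => measurable_block j b)
  rw [map_blocks] at h1
  change ∫⁻ ω, G (fun b => block j b ω) ∂(prodLaw ν) = _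
  rw [← h1]
  have hind : iIndepFun (fun (b : ℕ) (η : ℕ → Fin j → Ω) => g (η b))
      (Measure.infinitePi fun _ : ℕ => Measure.pi fun _ : Fin j => ν) :=
    iIndepFun_infinitePi (X := fun _ => g) fun _ => hg
  have h2 b : ∫⁻ η : ℕ → Fin j → Ω, g (η b)
      ∂(Measure.infinitePi fun _ : ℕ => Measure.pi fun _ : Fin j => ν) =
      ∫⁻ x, g x ∂(Measure.pi fun _ : Fin j => ν) :=
    (measurePreserving_eval_infinitePi
      (fun _ : ℕ => Measure.pi fun _ : Fin j => ν) b).lintegral_comp hg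
  simp only [G]
  rw [lintegral_prod_eq_prod_lintegral_of_indepFun _
    (fun (b : ℕ) (η : ℕ → Fin j → Ω) => g (η b)) hind fun b => hg.comp (measurable_pi_apply b)]
  simp [h2]

/-! ### Exchangeability -/

theorem measurePreserving_perm (σ : Equiv.Perm ℕ) :
    MeasurePreserving (fun (ω : ℕ → Ω) l => ω (σ l)) (prodLaw ν) (prodLaw ν) :=
  ⟨measurable_pi_iff.2 fun _ => measurable_pi_apply _,
    Measure.map_infinitePi_infinitePi_of_inj σ.injective⟩

theorem measurePreserving_perm_cond {σ : Equiv.Perm ℕ} {C : Set (ℕ → Ω)} (hC : MeasurableSet C)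
    (hσ : (fun (ω : ℕ → Ω) l => ω (σ l)) ⁻¹' C = C) :
    MeasurePreserving (fun (ω : ℕ → Ω) l => ω (σ l)) ((prodLaw ν)[|C]) ((prodLaw ν)[|C]) := by
  have h := (measurePreserving_perm (ν := ν) σ).restrict_preimage hC
  rw [hσ] at h
  exact h.smul_measure _

/-- Swap blocks 0 and `b` by acting on quotients modulo `j`. Indices from `n` on have quotient
greater than `b`, so they stay fixed. -/
theorem exists_perm_block {j b N n : ℕ} (hb : b < N) (hN : N * j ≤ n) :
    ∃ σ : Equiv.Perm ℕ, (∀ l, n ≤ l → σ l = l) ∧ ∀ i : Fin j, σ i = b * j + i := by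
  rcases Nat.eq_zero_or_pos j with rfl | hj
  · exact ⟨1, fun _ _ => rfl, fun i => i.elim0⟩
  have : NeZero j := ⟨hj.ne'⟩
  let e := Nat.divModEquiv j
  refine ⟨(e.trans ((Equiv.swap 0 b).prodCongr (Equiv.refl _))).trans e.symm, fun l hl => ?_,
    fun i => ?_⟩
  · have h1 : b < l / j := by
      rw [Nat.lt_iff_add_one_le, Nat.le_div_iff_mul_le hj]
      exact (Nat.mul_le_mul_right j hb).trans (hN.trans hl)
    have h2 : Equiv.swap 0 b (l / j) = l / j := Equiv.swap_apply_of_ne_of_ne (by omega) (by omega)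
    have h3 : e l = (l / j, Fin.ofNat j l) := rfl
    simp only [Equiv.trans_apply, h3, Equiv.prodCongr_apply, Prod.map, h2, Equiv.refl_apply]
    rw [← h3, Equiv.symm_apply_apply]
  · have h3 : e (i : ℕ) = (0, i) := by
      rw [← Equiv.eq_symm_apply]
      simp [e, Nat.divModEquiv]
    simp only [Equiv.trans_apply, h3, Equiv.prodCongr_apply, Prod.map, Equiv.swap_apply_left,
      Equiv.refl_apply]
    simp [e, Nat.divModEquiv]

end Microcanonical

namespace Microcanonical
open InformationTheory

variable {Ω : Type*} [MeasurableSpace Ω] {ν : Measure Ω} {p q : Ω → ℝ} {m : ℕ}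
  {ψ : Fin (m + 1) → Ω → ℝ} {a : Fin (m + 1) → ℝ} {δ : ℝ} {n : ℕ}

/-! ### The conditional law under the constraint -/

/-- The constraint that the empirical means of the observables are `δ`-close to `a`. -/
def constr (ψ : Fin (m + 1) → Ω → ℝ) (a : Fin (m + 1) → ℝ) (δ : ℝ) (n : ℕ) : Set (ℕ → Ω) :=
  {ω | ∀ i, |(∑ l ∈ Finset.range n, ψ i (ω l)) / n - a i| ≤ δ}

theorem measurable_sum_range {f : Ω → ℝ} (hf : Measurable f) (n : ℕ) :
    Measurable fun ω : ℕ → Ω => ∑ l ∈ Finset.range n, f (ω l) :=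
  Finset.measurable_sum _ fun l _ => hf.comp (measurable_pi_apply l)

theorem measurableSet_constr (hψ : ∀ i, Measurable (ψ i)) : MeasurableSet (constr ψ a δ n) := by
  have e : constr ψ a δ n =
      ⋂ i, {ω | |(∑ l ∈ Finset.range n, ψ i (ω l)) / n - a i| ≤ δ} := by
    ext; simp [constr]
  rw [e]
  refine MeasurableSet.iInter fun i => measurableSet_le ?_ measurable_const
  have := ((measurable_sum_range (hψ i) n).div_const n).sub_const (a i)
  simpa only [Real.norm_eq_abs] using this.norm

theorem preimage_perm_constr {α : Type*} {ψ : Fin (m + 1) → α → ℝ} {σ : Equiv.Perm ℕ} (hσ : ∀ l, n ≤ l → σ l = l) :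
    (fun (ω : ℕ → α) l => ω (σ l)) ⁻¹' constr ψ a δ n = constr ψ a δ n := by
  ext ω
  have h i : ∑ l ∈ Finset.range n, ψ i (ω (σ l)) = ∑ l ∈ Finset.range n, ψ i (ω l) :=
    Equiv.Perm.sum_comp σ _ (fun l => ψ i (ω l)) fun l hl => by
      simp only [Finset.coe_range, Set.mem_Iio]
      by_contra! h
      exact hl (hσ l h)
  simp [constr, h]

variable [IsProbabilityMeasure ν]

/-- The constraint is symmetric in the first `n` coordinates, so the permutation exchanging blocks 0
and `b` preserves the conditional law. -/
theorem map_block_cond (hψ : ∀ i, Measurable (ψ i)) {j b N : ℕ} (hb : b < N) (hN : N * j ≤ n) :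
    ((prodLaw ν)[|constr ψ a δ n]).map (block j b) =
      ((prodLaw ν)[|constr ψ a δ n]).map (fun ω (i : Fin j) => ω i) := by
  obtain ⟨σ, hσ, hσb⟩ := exists_perm_block hb hN
  have h := measurePreserving_perm_cond (ν := ν) (measurableSet_constr (a := a) (δ := δ) hψ)
    (preimage_perm_constr hσ)
  conv_rhs => rw [← h.map_eq]
  rw [Measure.map_map (measurable_pi_iff.2 fun _ => measurable_pi_apply _) h.measurable]
  congr 1
  ext ω i
  simp [block, hσb]

theorem map_eval_cond (hψ : ∀ i, Measurable (ψ i)) {l : ℕ} (hl : l < n) :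
    ((prodLaw ν)[|constr ψ a δ n]).map (fun ω => ω l) =
      ((prodLaw ν)[|constr ψ a δ n]).map (fun ω => ω 0) := by
  have h := map_block_cond (ν := ν) (a := a) (δ := δ) hψ (n := n) (j := 1) hl (mul_one n).le
  have hm : Measurable fun (ω : ℕ → Ω) (i : Fin 1) => ω i :=
    measurable_pi_iff.2 fun _ => measurable_pi_apply _
  have h2 := congrArg (fun κ => κ.map fun x : Fin 1 → Ω => x 0) h
  rw [Measure.map_map (measurable_pi_apply _) (measurable_block _ _),
    Measure.map_map (measurable_pi_apply _) hm] at h2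
  simpa [Function.comp_def, block] using h2

/-- Conditioning multiplies probabilities by at most `1 / ℙ(C)`. -/
theorem cond_le_smul (C : Set (ℕ → Ω)) (hC : prodLaw ν C ≠ 0) :
    ((prodLaw ν)[|C]).map (fun ω => ω 0) ≤ ((prodLaw ν C)⁻¹.toNNReal) • ν := by
  have hne : (prodLaw ν C)⁻¹ ≠ ⊤ := ENNReal.inv_ne_top.2 hC
  refine Measure.le_iff.2 fun s hs => ?_
  rw [Measure.map_apply (measurable_pi_apply 0) hs, ProbabilityTheory.cond, Measure.smul_apply, Measure.smul_apply,
    ENNReal.smul_def, ENNReal.coe_toNNReal hne]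
  refine mul_le_mul_right ?_ _
  refine (Measure.restrict_apply_le _ _).trans (le_of_eq ?_)
  exact (measurePreserving_eval_infinitePi (fun _ : ℕ => ν) 0).measure_preimage
    hs.nullMeasurableSet

/-- The law of one coordinate under the conditional law. -/
abbrev condLaw (ν : Measure Ω) (ψ : Fin (m + 1) → Ω → ℝ) (a : Fin (m + 1) → ℝ) (δ : ℝ) (n : ℕ) :
    Measure Ω := ((prodLaw ν)[|constr ψ a δ n]).map (fun ω => ω 0)

theorem condLaw_ac (hC : prodLaw ν (constr ψ a δ n) ≠ 0) : condLaw ν ψ a δ n ≪ ν :=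
  (Measure.absolutelyContinuous_of_le (cond_le_smul _ hC)).trans
    (Measure.AbsolutelyContinuous.rfl.smul_left _)

/-- By exchangeability the moments of one coordinate are the conditional means of the empirical
means, which the constraint keeps within `δ` of `a`. -/
theorem dens_condLaw_mem_feasible (hψ : Dominated ψ) (hn : 0 < n)
    (hC : prodLaw ν (constr ψ a δ n) ≠ 0) :
    dens ν (condLaw ν ψ a δ n) ∈ feasible ν ψ a δ := by
  have hk : IsProbabilityMeasure ((prodLaw ν)[|constr ψ a δ n]) := cond_isProbabilityMeasure hC
  have : IsProbabilityMeasure (condLaw ν ψ a δ n) :=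
    Measure.isProbabilityMeasure_map (measurable_pi_apply 0).aemeasurable
  have hac := condLaw_ac hC
  have hn' : (0 : ℝ) < n := Nat.cast_pos.2 hn
  set κ := (prodLaw ν)[|constr ψ a δ n]
  have hmem : ∀ᵐ ω ∂κ, ω ∈ constr ψ a δ n := ae_cond_mem (measurableSet_constr hψ.measurable)
  -- Each summand is nonnegative, hence at most the whole sum, which the constraint bounds.
  have hint i l (hl : l < n) : Integrable (fun ω => ψ i (ω l)) κ := by
    refine (integrable_const (n * (a i + δ))).mono'
      ((hψ.measurable i).comp (measurable_pi_apply l)).aestronglyMeasurable ?_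
    filter_upwards [hmem] with ω hω
    rw [Real.norm_of_nonneg (hψ.nonneg _ _)]
    refine (Finset.single_le_sum (f := fun l => ψ i (ω l)) (fun l _ => hψ.nonneg _ _)
      (Finset.mem_range.2 hl)).trans ?_
    have := (abs_le.1 (hω i)).2
    rw [sub_le_iff_le_add, div_le_iff₀ hn'] at this
    linarith
  have hmap i l : ∫ ω, ψ i (ω l) ∂κ = ∫ x, ψ i x ∂(κ.map fun ω => ω l) :=
    (integral_map (measurable_pi_apply l).aemeasurable
      (hψ.measurable i).aestronglyMeasurable).symm
  have hint0 i : Integrable (ψ i) (condLaw ν ψ a δ n) :=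
    (integrable_map_measure (hψ.measurable i).aestronglyMeasurable
      (measurable_pi_apply 0).aemeasurable).2 (hint i 0 hn)
  have hmean i : ∫ x, ψ i x ∂(condLaw ν ψ a δ n) =
      ∫ ω, (∑ l ∈ Finset.range n, ψ i (ω l)) / n ∂κ := by
    rw [integral_div, integral_finsetSum _ fun l hl => hint i l (Finset.mem_range.1 hl),
      Finset.sum_congr rfl (g := fun _ => ∫ x, ψ i x ∂(condLaw ν ψ a δ n)) fun l hl => by
        rw [hmap, map_eval_cond hψ.measurable (Finset.mem_range.1 hl)]]
    rw [Finset.sum_const, Finset.card_range, nsmul_eq_mul]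
    field_simp
  have hsumint i : Integrable (fun ω => (∑ l ∈ Finset.range n, ψ i (ω l)) / n) κ :=
    (integrable_finsetSum _ fun l hl => hint i l (Finset.mem_range.1 hl)).div_const _
  have hle i : ∫ x, ψ i x ∂(condLaw ν ψ a δ n) ≤ a i + δ := by
    rw [hmean]
    have := integral_mono_ae (hsumint i) (integrable_const (a i + δ)) (hmem.mono fun ω hω => by
      have := (abs_le.1 (hω i)).2
      simp only
      linarith)
    simpa using this
  have hge i : a i - δ ≤ ∫ x, ψ i x ∂(condLaw ν ψ a δ n) := by
    rw [hmean]
    have := integral_mono_ae (integrable_const (a i - δ)) (hsumint i) (hmem.mono fun ω hω => by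
      have := (abs_le.1 (hω i)).1
      simp only
      linarith)
    simpa using this
  refine ⟨isDensity_dens hac, fun i => (integrable_dens_mul_iff hac).2 (hint0 i), fun i => ?_, ?_⟩
  · rw [integral_dens_mul hac, abs_le]
    constructor <;> linarith [hle i.castSucc, hge i.castSucc]
  · rw [integral_dens_mul hac]
    exact hle _

theorem ofReal_exp_sum_log {s : Finset ℕ} {x : ℕ → ℝ} (hx : ∀ l ∈ s, 0 < x l) :
    ENNReal.ofReal (Real.exp (∑ l ∈ s, Real.log (x l))) = ∏ l ∈ s, ENNReal.ofReal (x l) := by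
  rw [Real.exp_sum, ENNReal.ofReal_prod_of_nonneg fun _ _ => (Real.exp_pos _).le]
  exact Finset.prod_congr rfl fun l hl => by rw [Real.exp_log (hx l hl)]

/-- The entropy bound: the exponential moments, under the entropy projection, of functions of blocks
of coordinates control their conditional means. -/
theorem mul_kl_add_le (hψ : Dominated ψ) (hp : p ∈ feasible ν ψ a δ) (fp : FiniteKL ν p)
    (hmin : ∀ q ∈ feasible ν ψ a δ, FiniteKL ν q → kl ν p ≤ kl ν q) (hn : 0 < n)
    (hC : prodLaw ν (constr ψ a δ n) ≠ 0) {j N : ℕ} (hN : N * j ≤ n) {f : (Fin j → Ω) → ℝ}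
    (hf : Measurable f) {B : ℝ} (hB : ∀ x, |f x| ≤ B) :
    n * kl ν p + N * ∫ ω, f (fun i : Fin j => ω i) ∂((prodLaw ν)[|constr ψ a δ n]) ≤
      -Real.log ((prodLaw ν).real (constr ψ a δ n)) +
        N * Real.log (∫ x, Real.exp (f x) ∂(Measure.pi fun _ : Fin j => withDens ν p)) := by
  have hk : IsProbabilityMeasure ((prodLaw ν)[|constr ψ a δ n]) := cond_isProbabilityMeasure hC
  have : IsProbabilityMeasure (condLaw ν ψ a δ n) :=
    Measure.isProbabilityMeasure_map (measurable_pi_apply 0).aemeasurable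
  have hpp := hp.1.isProbabilityMeasure
  have hac := condLaw_ac hC
  have hCm : MeasurableSet (constr ψ a δ n) := measurableSet_constr hψ.measurable
  obtain ⟨h0, hlogi, hlog⟩ := kl_le_integral_mul_log convex_feasible (fun _ h => h.1) hp fp hmin
    (dens_condLaw_mem_feasible hψ hn hC)
    (finiteKL_dens_of_le_smul hac (cond_le_smul _ hC))
  rw [integrable_dens_mul_iff hac] at hlogi
  rw [integral_dens_mul hac] at hlog
  -- Needed to write the product of the `p (ω l)` as the exponential of `F₁`, since `log 0 = 0`
  -- would break the identity.
  have hpos : ∀ᵐ x ∂(condLaw ν ψ a δ n), 0 < p x := by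
    rw [← withDens_dens hac, withDens,
      ae_withDensity_iff (isDensity_dens hac).measurable.ennreal_ofReal]
    filter_upwards [h0] with x hx hne
    refine (hp.1.nonneg x).lt_of_ne' fun hpx => hne ?_
    rw [hx hpx, ENNReal.ofReal_zero]
  set C := constr ψ a δ n
  set κ := (prodLaw ν)[|C]
  have hlm : Measurable fun x => Real.log (p x) := hp.1.measurable.log
  have hpos' : ∀ᵐ ω ∂κ, ∀ l ∈ Finset.range n, 0 < p (ω l) := by
    refine (Finset.eventually_all _).2 fun l hl => ?_
    have := map_eval_cond (ν := ν) (a := a) (δ := δ) hψ.measurable (Finset.mem_range.1 hl)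
    refine ae_of_ae_map (f := fun ω : ℕ → Ω => ω l) (p := fun x => 0 < p x)
      (measurable_pi_apply l).aemeasurable ?_
    rw [this]
    exact hpos
  have hli l (hl : l < n) : Integrable (fun ω => Real.log (p (ω l))) κ ∧
      kl ν p ≤ ∫ ω, Real.log (p (ω l)) ∂κ := by
    have hm := map_eval_cond (ν := ν) (a := a) (δ := δ) hψ.measurable hl
    have h1 := integrable_map_measure (μ := κ) (f := fun ω : ℕ → Ω => ω l)
      hlm.aestronglyMeasurable (measurable_pi_apply l).aemeasurable
    have h2 := integral_map (μ := κ) (φ := fun ω : ℕ → Ω => ω l)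
      (measurable_pi_apply l).aemeasurable hlm.aestronglyMeasurable
    rw [hm] at h1 h2
    exact ⟨h1.1 hlogi, hlog.trans h2.le⟩
  have hbm b : Measurable fun ω : ℕ → Ω => f (block j b ω) := hf.comp (measurable_block j b)
  have hbi b : Integrable (fun ω => f (block j b ω)) κ :=
    (integrable_const B).mono' (hbm b).aestronglyMeasurable (.of_forall fun ω => hB _)
  have hbint b (hb : b < N) :
      ∫ ω, f (block j b ω) ∂κ = ∫ ω, f (fun i : Fin j => ω i) ∂κ := by
    have h1 := integral_map (μ := κ) (measurable_block j b).aemeasurable hf.aestronglyMeasurable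
    have h2 := integral_map (μ := κ) (φ := fun ω (i : Fin j) => ω i)
      (measurable_pi_iff.2 fun _ => measurable_pi_apply _).aemeasurable hf.aestronglyMeasurable
    rw [← h1, ← h2, map_block_cond hψ.measurable hb hN]
  let F₁ (ω : ℕ → Ω) : ℝ := ∑ l ∈ Finset.range n, Real.log (p (ω l))
  let F₂ (ω : ℕ → Ω) : ℝ := ∑ b ∈ Finset.range N, f (block j b ω)
  have hF₁ : Integrable F₁ κ :=
    integrable_finsetSum _ fun l hl => (hli l (Finset.mem_range.1 hl)).1
  have hF₂ : Integrable F₂ κ := integrable_finsetSum _ fun b _ => hbi b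
  have hF₂m : Measurable F₂ := Finset.measurable_sum _ fun b _ => hbm b
  -- Each coordinate contributes at least `kl ν p` by the variational inequality, and all blocks
  -- have the same conditional mean by exchangeability.
  have hF : n * kl ν p + N * ∫ ω, f (fun i : Fin j => ω i) ∂κ ≤ ∫ ω, F₁ ω + F₂ ω ∂κ := by
    rw [integral_add hF₁ hF₂, integral_finsetSum _ fun l hl => (hli l (Finset.mem_range.1 hl)).1,
      integral_finsetSum _ fun b _ => hbi b]
    refine add_le_add ?_ (le_of_eq ?_)
    · have := Finset.card_nsmul_le_sum (Finset.range n) (fun l => ∫ ω, Real.log (p (ω l)) ∂κ)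
        (kl ν p) fun l hl => (hli l (Finset.mem_range.1 hl)).2
      simpa using this
    · rw [Finset.sum_congr rfl fun b hb => hbint b (Finset.mem_range.1 hb)]
      simp
  set I := ∫ x, Real.exp (f x) ∂(Measure.pi fun _ : Fin j => withDens ν p)
  have hexpi : Integrable (fun x => Real.exp (f x)) (Measure.pi fun _ : Fin j => withDens ν p) :=
    (integrable_const (Real.exp B)).mono' hf.exp.aestronglyMeasurable (.of_forall fun x => by
      rw [Real.norm_of_nonneg (Real.exp_pos _).le]
      exact Real.exp_le_exp.2 ((le_abs_self _).trans (hB x)))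
  have hIpos : 0 < I := integral_exp_pos hexpi
  have hPC : 0 < (prodLaw ν).real C := ENNReal.toReal_pos hC (measure_ne_top _ _)
  have hlint : ∫⁻ ω, ENNReal.ofReal (Real.exp (F₁ ω + F₂ ω)) ∂κ ≤
      ENNReal.ofReal (((prodLaw ν).real C)⁻¹ * I ^ N) := by
    have hae : ∀ᵐ ω ∂κ, ENNReal.ofReal (Real.exp (F₁ ω + F₂ ω)) =
        (∏ l ∈ Finset.range n, ENNReal.ofReal (p (ω l))) *
          ENNReal.ofReal (Real.exp (F₂ ω)) := by
      filter_upwards [hpos'] with ω hω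
      rw [Real.exp_add, ENNReal.ofReal_mul (Real.exp_pos _).le, ofReal_exp_sum_log hω]
    rw [lintegral_congr_ae hae]
    have hdep : DependsOn (fun ω => ENNReal.ofReal (Real.exp (F₂ ω))) (Set.Iio n) := by
      intro ω ω' h
      have : F₂ ω = F₂ ω' := Finset.sum_congr rfl fun b hb => by
        have : block j b ω = block j b ω' :=
          funext fun i => h _ (block_lt (Finset.mem_range.1 hb) hN i)
        rw [this]
      simp only [this]
    have hprod ω : ENNReal.ofReal (Real.exp (F₂ ω)) =
        ∏ b ∈ Finset.range N, ENNReal.ofReal (Real.exp (f (block j b ω))) := by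
      rw [Real.exp_sum, ENNReal.ofReal_prod_of_nonneg fun _ _ => (Real.exp_pos _).le]
    -- Drop the restriction to `C`, at the price of an inequality; the weight then turns `ν` into
    -- the law with density `p`, under which the blocks are independent.
    calc ∫⁻ ω, (∏ l ∈ Finset.range n, ENNReal.ofReal (p (ω l))) *
          ENNReal.ofReal (Real.exp (F₂ ω)) ∂κ
        ≤ (prodLaw ν C)⁻¹ * ∫⁻ ω, (∏ l ∈ Finset.range n, ENNReal.ofReal (p (ω l))) *
          ENNReal.ofReal (Real.exp (F₂ ω)) ∂(prodLaw ν) := by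
          rw [show κ = (prodLaw ν C)⁻¹ • (prodLaw ν).restrict C from rfl, lintegral_smul_measure]
          exact mul_le_mul_right (lintegral_mono' Measure.restrict_le_self le_rfl) _
      _ = (prodLaw ν C)⁻¹ * ENNReal.ofReal I ^ N := by
          rw [lintegral_prod_mul_eq hp.1 n hF₂m.exp.ennreal_ofReal hdep]
          simp_rw [hprod]
          rw [lintegral_prod_block j N hf.exp.ennreal_ofReal,
            ofReal_integral_eq_lintegral_ofReal hexpi (.of_forall fun _ => (Real.exp_pos _).le)]
      _ = ENNReal.ofReal (((prodLaw ν).real C)⁻¹ * I ^ N) := by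
          rw [ENNReal.ofReal_mul (inv_nonneg.2 hPC.le), ENNReal.ofReal_inv_of_pos hPC,
            ENNReal.ofReal_pow hIpos.le, Measure.real, ENNReal.ofReal_toReal (measure_ne_top _ _)]
  have hFm : AEStronglyMeasurable (fun ω => Real.exp (F₁ ω + F₂ ω)) κ :=
    ((measurable_sum_range hlm n).add hF₂m).exp.aestronglyMeasurable
  have hei : Integrable (fun ω => Real.exp (F₁ ω + F₂ ω)) κ := by
    refine ⟨hFm, ?_⟩
    rw [hasFiniteIntegral_iff_ofReal (.of_forall fun _ => (Real.exp_pos _).le)]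
    exact hlint.trans_lt ENNReal.ofReal_lt_top
  rw [← ofReal_integral_eq_lintegral_ofReal hei (.of_forall fun _ => (Real.exp_pos _).le),
    ENNReal.ofReal_le_ofReal_iff (by positivity)] at hlint
  have hjensen := convexOn_exp.map_integral_le (μ := κ) Real.continuous_exp.continuousOn
    isClosed_univ (f := fun ω => F₁ ω + F₂ ω) (.of_forall fun _ => Set.mem_univ _) (hF₁.add hF₂) hei
  have hfin := Real.log_le_log (Real.exp_pos _) (hjensen.trans hlint)
  rw [Real.log_exp, Real.log_mul (inv_ne_zero hPC.ne') (pow_ne_zero _ hIpos.ne'), Real.log_inv,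
    Real.log_pow] at hfin
  exact hF.trans hfin

end Microcanonical

namespace Microcanonical
open InformationTheory

variable {Ω : Type*} [MeasurableSpace Ω] {ν : Measure Ω} {r : Ω → ℝ} {m : ℕ}
  {ψ : Fin (m + 1) → Ω → ℝ} {a : Fin (m + 1) → ℝ} {δ : ℝ}

/-! ### The lower bound for the probability of the constraint -/

theorem tendsto_mean_ae {ρ : Measure Ω} [IsProbabilityMeasure ρ] {g : Ω → ℝ} (hg : Measurable g)
    (hi : Integrable g ρ) :
    ∀ᵐ ω ∂(prodLaw ρ), Tendsto (fun n : ℕ => (∑ l ∈ Finset.range n, g (ω l)) / n) atTop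
      (𝓝 (∫ x, g x ∂ρ)) := by
  have hmap l : MeasurePreserving (fun ω : ℕ → Ω => ω l) (prodLaw ρ) ρ :=
    measurePreserving_eval_infinitePi (fun _ : ℕ => ρ) l
  have hind : iIndepFun (fun l (ω : ℕ → Ω) => g (ω l)) (prodLaw ρ) :=
    iIndepFun_infinitePi (X := fun _ => g) fun _ => hg
  have h := strong_law_ae_real (μ := prodLaw ρ) (fun l ω => g (ω l))
    ((hmap 0).integrable_comp_of_integrable hi) (fun i j hij => hind.indepFun hij) fun i =>
      ⟨(hg.comp (measurable_pi_apply i)).aemeasurable, (hg.comp (measurable_pi_apply 0)).aemeasurable,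
        by
          have e l : (prodLaw ρ).map (fun ω => g (ω l)) = ρ.map g := by
            conv_rhs => rw [← (hmap l).map_eq, Measure.map_map hg (measurable_pi_apply l)]
            rfl
          rw [e, e]⟩
  have e : ∫ ω, g (ω 0) ∂(prodLaw ρ) = ∫ x, g x ∂ρ := by
    conv_rhs => rw [← (hmap 0).map_eq]
    rw [integral_map (measurable_pi_apply 0).aemeasurable hg.aestronglyMeasurable]
  rwa [e] at h

/-- The typical configurations for the law with density `r`. -/
def typicalSet (ν : Measure Ω) (ψ : Fin (m + 1) → Ω → ℝ) (r : Ω → ℝ) (η : ℝ) (n : ℕ) :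
    Set (ℕ → Ω) :=
  {ω | (∀ i, |∑ l ∈ Finset.range n, ψ i (ω l) - n * ∫ x, r x * ψ i x ∂ν| ≤ n * η) ∧
    ∑ l ∈ Finset.range n, Real.log (r (ω l)) ≤ n * (kl ν r + η) ∧
    ∀ l ∈ Finset.range n, 0 < r (ω l)}

theorem dependsOn_typicalSet {η : ℝ} {n : ℕ} :
    DependsOn (· ∈ typicalSet ν ψ r η n) (Set.Iio n) := by
  intro ω ω' h
  have h1 (f : Ω → ℝ) : ∑ l ∈ Finset.range n, f (ω l) = ∑ l ∈ Finset.range n, f (ω' l) :=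
    Finset.sum_congr rfl fun l hl => by rw [h l (Finset.mem_range.1 hl)]
  have h2 : (∀ l ∈ Finset.range n, 0 < r (ω l)) ↔ ∀ l ∈ Finset.range n, 0 < r (ω' l) :=
    forall₂_congr fun l hl => by rw [h l (Finset.mem_range.1 hl)]
  simp only [typicalSet, Set.mem_ofPred_eq, h1 (ψ _), h1 fun x => Real.log (r x), h2]

theorem measurableSet_forall_le {ι α : Type*} [Countable ι] [MeasurableSpace α] {f g : ι → α → ℝ}
    (hf : ∀ i, Measurable (f i)) (hg : ∀ i, Measurable (g i)) :
    MeasurableSet {x | ∀ i, f i x ≤ g i x} := by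
  have e : {x | ∀ i, f i x ≤ g i x} = ⋂ i, {x | f i x ≤ g i x} := by ext; simp
  rw [e]
  exact MeasurableSet.iInter fun i => measurableSet_le (hf i) (hg i)

theorem measurableSet_typicalSet (hψ : ∀ i, Measurable (ψ i)) (hr : IsDensity ν r) {η : ℝ} {n : ℕ} :
    MeasurableSet (typicalSet ν ψ r η n) := by
  have e : typicalSet ν ψ r η n =
      {ω | ∀ i, |∑ l ∈ Finset.range n, ψ i (ω l) - n * ∫ x, r x * ψ i x ∂ν| ≤ n * η} ∩
      ({ω | ∑ l ∈ Finset.range n, Real.log (r (ω l)) ≤ n * (kl ν r + η)} ∩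
        ⋂ l ∈ Finset.range n, {ω | 0 < r (ω l)}) := by
    ext; simp [typicalSet]
  rw [e]
  refine (measurableSet_forall_le (fun i => ?_) fun i => measurable_const).inter
    ((measurableSet_le (measurable_sum_range hr.measurable.log n) measurable_const).inter
      (Finset.measurableSet_biInter _ fun l _ =>
        measurableSet_lt measurable_const (hr.measurable.comp (measurable_pi_apply l))))
  have := (measurable_sum_range (hψ i) n).sub_const (n * ∫ x, r x * ψ i x ∂ν)
  simpa only [Real.norm_eq_abs] using this.norm

variable [IsProbabilityMeasure ν]

/-- `D` is an event of the coordinates below `n`, hence independent of coordinate `n`. -/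
theorem measure_inter_eval {n : ℕ} {D : Set (ℕ → Ω)} (hD : MeasurableSet D)
    (hdep : DependsOn (· ∈ D) (Set.Iio n)) {J : Set Ω} (hJ : MeasurableSet J) :
    prodLaw ν (D ∩ {ω | ω n ∈ J}) = prodLaw ν D * ν J := by
  have : Nonempty Ω := nonempty_of_isProbabilityMeasure ν
  obtain ⟨D', hD', hDe⟩ := exists_measurable_factor (measurable_mem.2 hD) hdep
  have hD'm : MeasurableSet {x | D' x} := measurableSet_setOfPred.2 hD'
  have hind : iIndepFun (fun l (ω : ℕ → Ω) => ω l) (prodLaw ν) :=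
    iIndepFun_infinitePi (X := fun _ x => x) fun _ => measurable_id
  have hm₁ : Measurable fun (x : Finset.range n → Ω) (i : Fin n) =>
      x ⟨i, Finset.mem_range.2 i.isLt⟩ := measurable_pi_iff.2 fun _ => measurable_pi_apply _
  have hm₂ : Measurable fun x : ({n} : Finset ℕ) → Ω => x ⟨n, Finset.mem_singleton_self n⟩ :=
    measurable_pi_apply _
  have h := (hind.indepFun_finset (Finset.range n) {n} (by simp)
    fun l => measurable_pi_apply l).comp hm₁ hm₂
  have h2 := h.measure_inter_preimage_eq_mul _ _ hD'm hJ
  have e1 : D = (fun (ω : ℕ → Ω) (i : Fin n) => ω i) ⁻¹' {x | D' x} := by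
    ext ω
    exact iff_of_eq (hDe ω)
  have e2 : prodLaw ν ((fun ω : ℕ → Ω => ω n) ⁻¹' J) = ν J :=
    (measurePreserving_eval_infinitePi (fun _ : ℕ => ν) n).measure_preimage hJ.nullMeasurableSet
  rw [← e2, e1]
  exact h2

/-- A single coordinate can carry a macroscopic part of the last moment at a subexponential cost. -/
def SubexponentialTail (ν : Measure Ω) (ψ : Fin (m + 1) → Ω → ℝ) : Prop :=
  ∀ c η : ℝ, 0 < η → η < c → ∀ᶠ n : ℕ in atTop, Real.exp (-(n * η)) ≤
    ν.real {x | |ψ (Fin.last m) x - n * c| ≤ n * η ∧ ∀ i : Fin m, ψ i.castSucc x ≤ n * η}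

theorem tendsto_measure_typicalSet (hψ : ∀ i, Measurable (ψ i)) (hr : IsDensity ν r)
    (fr : FiniteKL ν r) (hi : ∀ i, Integrable (fun x => r x * ψ i x) ν) {η : ℝ} (hη : 0 < η) :
    Tendsto (fun n => prodLaw (withDens ν r) (typicalSet ν ψ r η n)) atTop (𝓝 1) := by
  have := hr.isProbabilityMeasure
  have hpos : ∀ᵐ ω ∂(prodLaw (withDens ν r)), ∀ l, 0 < r (ω l) := by
    refine ae_all_iff.2 fun l => ?_
    refine ae_of_ae_map (f := fun ω : ℕ → Ω => ω l) (p := fun x => 0 < r x)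
      (measurable_pi_apply l).aemeasurable ?_
    rw [Measure.infinitePi_map_eval, withDens, ae_withDensity_iff hr.measurable.ennreal_ofReal]
    refine .of_forall fun x hne => (hr.nonneg x).lt_of_ne' fun h => hne ?_
    rw [h, ENNReal.ofReal_zero]
  have hlog := tendsto_mean_ae (ρ := withDens ν r) hr.measurable.log
    ((integrable_withDens_iff hr _).2 (integrable_mul_log hr fr).1)
  rw [integral_withDens hr, (integrable_mul_log hr fr).2] at hlog
  have hmom : ∀ᵐ ω ∂(prodLaw (withDens ν r)), ∀ i, Tendsto
      (fun n : ℕ => (∑ l ∈ Finset.range n, ψ i (ω l)) / n) atTop (𝓝 (∫ x, r x * ψ i x ∂ν)) := by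
    refine ae_all_iff.2 fun i => ?_
    rw [← integral_withDens hr]
    exact tendsto_mean_ae (hψ i) ((integrable_withDens_iff hr _).2 (hi i))
  have hlim := tendsto_measure_of_ae_tendsto_indicator_of_isFiniteMeasure (L := atTop)
    (μ := prodLaw (withDens ν r)) (A := Set.univ) (As := typicalSet ν ψ r η)
    MeasurableSet.univ (fun n => measurableSet_typicalSet hψ hr) (by
      filter_upwards [hpos, hlog, hmom] with ω h1 h2 h3
      have h3' : ∀ᶠ n : ℕ in atTop, ∀ i,
          |(∑ l ∈ Finset.range n, ψ i (ω l)) / n - ∫ x, r x * ψ i x ∂ν| < η :=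
        eventually_all.2 fun i => by
          have := Metric.tendsto_nhds.1 (h3 i) η hη
          simpa only [Real.dist_eq] using this
      filter_upwards [h3', h2.eventually_lt_const (lt_add_of_pos_right _ hη),
        eventually_gt_atTop 0] with n h3 h2 hn
      have hn : (0 : ℝ) < n := Nat.cast_pos.2 hn
      refine iff_of_true ⟨fun i => ?_, ?_, fun l _ => h1 l⟩ (Set.mem_univ _)
      · have e : ∑ l ∈ Finset.range n, ψ i (ω l) - n * ∫ x, r x * ψ i x ∂ν =
            n * ((∑ l ∈ Finset.range n, ψ i (ω l)) / n - ∫ x, r x * ψ i x ∂ν) := by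
          field_simp
        rw [e, abs_mul, abs_of_pos hn]
        exact mul_le_mul_of_nonneg_left (h3 i).le hn.le
      · rw [div_lt_iff₀ hn] at h2
        linarith)
  simpa using hlim

theorem measure_typicalSet_le (hψ : ∀ i, Measurable (ψ i)) (hr : IsDensity ν r) {η : ℝ} {n : ℕ} :
    prodLaw (withDens ν r) (typicalSet ν ψ r η n) ≤
      ENNReal.ofReal (Real.exp (n * (kl ν r + η))) * prodLaw ν (typicalSet ν ψ r η n) := by
  set D := typicalSet ν ψ r η n with hDdef
  have hD : MeasurableSet D := measurableSet_typicalSet hψ hr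
  have hdep : DependsOn (D.indicator (1 : (ℕ → Ω) → ENNReal)) (Set.Iio n) := by
    intro ω ω' h
    have h' : (ω ∈ D) = (ω' ∈ D) := dependsOn_typicalSet h
    by_cases hω : ω ∈ D
    · rw [Set.indicator_of_mem hω, Set.indicator_of_mem (h' ▸ hω)]; rfl
    · rw [Set.indicator_of_notMem hω, Set.indicator_of_notMem (h' ▸ hω)]
  have h := lintegral_prod_mul_eq hr n (measurable_one.indicator hD) hdep
  rw [lintegral_indicator_one hD] at h
  rw [← h, ← lintegral_indicator_one hD, ← lintegral_const_mul _ (measurable_one.indicator hD)]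
  refine lintegral_mono fun ω => ?_
  -- On the typical set the density of the tilted law is at most `exp (n (kl + η))`; the positivity
  -- clause makes the logarithms legitimate.
  by_cases hω : ω ∈ D
  · refine mul_le_mul_left ?_ _
    rw [← ofReal_exp_sum_log hω.2.2]
    exact ENNReal.ofReal_le_ofReal (Real.exp_le_exp.2 hω.2.1)
  · simp [Set.indicator_of_notMem hω]

/-- If the law with density `r` satisfies the constraints strictly, its relative entropy bounds the
exponential rate of decay of the probability of the constraint. -/
theorem eventually_exp_le_measure_constr (hψ : Dominated ψ) (htail : SubexponentialTail ν ψ)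
    (hr : IsDensity ν r) (fr : FiniteKL ν r) (hi : ∀ i, Integrable (fun x => r x * ψ i x) ν)
    (hδ : 0 < δ) (hmom : ∀ i : Fin m, |∫ x, r x * ψ i.castSucc x ∂ν - a i.castSucc| < δ)
    (hlast : ∫ x, r x * ψ (Fin.last m) x ∂ν < a (Fin.last m) + δ) {ε : ℝ} (hε : 0 < ε) :
    ∀ᶠ n : ℕ in atTop, Real.exp (-(n * (kl ν r + ε))) ≤ (prodLaw ν).real (constr ψ a δ n) := by
  let M (i : Fin (m + 1)) : ℝ := ∫ x, r x * ψ i x ∂ν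
  -- `t` is the target for the last empirical mean: within `δ` of `a_k` and strictly above the
  -- moment under `r`. The excess `c > 0` is carried by one extra coordinate.
  obtain ⟨t, ht1, ht2⟩ : ∃ t, max (M (Fin.last m)) (a (Fin.last m) - δ) < t ∧
      t < a (Fin.last m) + δ :=
    exists_between (max_lt hlast (by linarith))
  rw [max_lt_iff] at ht1
  let c := t - M (Fin.last m)
  have hc : 0 < c := sub_pos.2 ht1.1
  -- Of the `3 * η`, one is the fluctuation in the typical set, one comes from the extra coordinate
  -- and one from passing from `n` to `n + 1`. The `2 * η` pays for the tilt and for the tail.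
  obtain ⟨η, hη, hηε, hηc, hηm, hηl⟩ : ∃ η : ℝ, 0 < η ∧ 2 * η < ε ∧ η < c ∧
      (∀ i : Fin m, |M i.castSucc - a i.castSucc| + 3 * η < δ) ∧
      |t - a (Fin.last m)| + 3 * η < δ := by
    have hlim (b s : ℝ) (u : ℝ) (h : b < u) : ∀ᶠ η in 𝓝[>] (0 : ℝ), b + s * η < u := by
      have : Tendsto (fun η : ℝ => b + s * η) (𝓝[>] 0) (𝓝 (b + s * 0)) :=
        ((continuous_const.add (continuous_const.mul continuous_id)).tendsto 0).mono_left
          nhdsWithin_le_nhds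
      exact this.eventually_lt_const (by simpa using h)
    have habs : |t - a (Fin.last m)| < δ := abs_lt.2 ⟨by linarith, by linarith⟩
    obtain ⟨η, h1, h2, h3, h4, h5⟩ := (eventually_mem_nhdsWithin.and ((hlim 0 2 ε hε).and
      ((hlim 0 1 c hc).and ((eventually_all.2 fun i : Fin m => hlim _ 3 δ (hmom i)).and
        (hlim _ 3 δ habs))))).exists
    exact ⟨η, h1, by linarith, by linarith, h4, h5⟩
  have hhalf := (tendsto_measure_typicalSet hψ.measurable hr fr hi hη).eventually_const_le
    (u := ENNReal.ofReal (1 / 2)) (by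
      rw [← ENNReal.ofReal_one]
      exact (ENNReal.ofReal_lt_ofReal_iff one_pos).2 (by norm_num))
  have hbig : ∀ᶠ n : ℕ in atTop, ∀ i, |M i| + c ≤ (n + 1) * η ∧ Real.log 2 ≤ n * (ε - 2 * η) := by
    refine eventually_all.2 fun i => ?_
    have h1 := (tendsto_natCast_atTop_atTop (R := ℝ)).atTop_mul_const hη
    have h2 := (tendsto_natCast_atTop_atTop (R := ℝ)).atTop_mul_const (sub_pos.2 hηε)
    filter_upwards [h1.eventually_ge_atTop (|M i| + c), h2.eventually_ge_atTop (Real.log 2)]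
      with n h1 h2
    exact ⟨by nlinarith, h2⟩
  -- The configuration consists of `n` typical coordinates followed by one, of index `n`, in `J`.
  have hmain : ∀ᶠ n : ℕ in atTop,
      Real.exp (-((n + 1 : ℕ) * (kl ν r + ε))) ≤ (prodLaw ν).real (constr ψ a δ (n + 1)) := by
    filter_upwards [hhalf, hbig, htail c η hη hηc] with n hhalf hbig htail
    set D := typicalSet ν ψ r η n
    set J := {x | |ψ (Fin.last m) x - n * c| ≤ n * η ∧ ∀ i : Fin m, ψ i.castSucc x ≤ n * η}
    have hD : MeasurableSet D := measurableSet_typicalSet hψ.measurable hr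
    have hJ : MeasurableSet J := by
      have e : J = {x | |ψ (Fin.last m) x - n * c| ≤ n * η} ∩
          {x | ∀ i : Fin m, ψ i.castSucc x ≤ n * η} := rfl
      rw [e]
      refine (measurableSet_le ?_ measurable_const).inter
        (measurableSet_forall_le (fun i => hψ.measurable _) fun _ => measurable_const)
      have := (hψ.measurable (Fin.last m)).sub_const (n * c)
      simpa only [Real.norm_eq_abs] using this.norm
    have hsub : D ∩ {ω | ω n ∈ J} ⊆ constr ψ a δ (n + 1) := by
      rintro ω ⟨hω, hωJ⟩ i
      have hn1 : (0 : ℝ) < (n : ℝ) + 1 := by positivity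
      have hnn : (0 : ℝ) ≤ n := n.cast_nonneg
      have hS := abs_le.1 (hω.1 i)
      have hMi := (hbig i).1
      have hMa := abs_le.1 (le_refl |M i|)
      change - (n * η) ≤ _ - n * M i ∧ _ - n * M i ≤ n * η at hS
      rw [Finset.sum_range_succ]
      set S := ∑ l ∈ Finset.range n, ψ i (ω l)
      push_cast
      rw [abs_le, le_sub_iff_add_le, sub_le_iff_le_add, div_le_iff₀ hn1, le_div_iff₀ hn1]
      induction i using Fin.lastCases with
      | last =>
        have hx := abs_le.1 hωJ.1
        have ht : t = M (Fin.last m) + c := by simp [c]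
        have hta := abs_lt.1 (show |t - a (Fin.last m)| < δ - 3 * η by linarith)
        constructor <;> nlinarith
      | cast i =>
        have hx := hωJ.2 i
        have hx0 := hψ.nonneg i.castSucc (ω n)
        have hta := abs_lt.1 (show |M i.castSucc - a i.castSucc| < δ - 3 * η by linarith [hηm i])
        constructor <;> nlinarith
    have hPD : 1 / 2 ≤ Real.exp (n * (kl ν r + η)) * (prodLaw ν).real D := by
      have h := hhalf.trans (measure_typicalSet_le hψ.measurable hr)
      have h2 := ENNReal.toReal_mono
        (ENNReal.mul_ne_top ENNReal.ofReal_ne_top (measure_ne_top _ _)) h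
      rwa [ENNReal.toReal_mul, ENNReal.toReal_ofReal (by norm_num),
        ENNReal.toReal_ofReal (Real.exp_pos _).le] at h2
    have hprod : (prodLaw ν).real (D ∩ {ω | ω n ∈ J}) = (prodLaw ν).real D * ν.real J := by
      simp only [Measure.real]
      rw [measure_inter_eval hD dependsOn_typicalSet hJ, ENNReal.toReal_mul]
    refine le_trans ?_ (measureReal_mono hsub)
    rw [hprod]
    have hPD' : Real.exp (-(n * (kl ν r + η)) - Real.log 2) ≤ (prodLaw ν).real D := by
      rw [Real.exp_sub, Real.exp_neg, Real.exp_log two_pos, div_le_iff₀ two_pos,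
        inv_le_iff_one_le_mul₀ (Real.exp_pos _)]
      linarith
    refine le_trans ?_ (mul_le_mul hPD' htail (Real.exp_pos _).le measureReal_nonneg)
    rw [← Real.exp_add, Real.exp_le_exp]
    push_cast
    nlinarith [(hbig 0).2, kl_nonneg hr]
  obtain ⟨n₀, hn₀⟩ := eventually_atTop.1 hmain
  refine eventually_atTop.2 ⟨n₀ + 1, fun n hn => ?_⟩
  obtain ⟨k, rfl⟩ : ∃ k, n = k + 1 := ⟨n - 1, by omega⟩
  exact hn₀ k (by omega)

end Microcanonical

namespace Microcanonical
open InformationTheory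

variable {Ω : Type*} [MeasurableSpace Ω] {ν : Measure Ω} [IsProbabilityMeasure ν] {p q : Ω → ℝ}
  {m : ℕ} {ψ : Fin (m + 1) → Ω → ℝ} {a : Fin (m + 1) → ℝ} {δ : ℝ}

/-! ### Convergence of the conditional laws -/

/-- The constraint has exponentially the probability predicted by the entropy projection `p`, as
soon as some law `q` of finite relative entropy satisfies the constraints strictly. -/
theorem eventually_exp_le_of_isMin (hψ : Dominated ψ) (htail : SubexponentialTail ν ψ)
    (hδ : 0 < δ) (hp : p ∈ feasible ν ψ a δ) (fp : FiniteKL ν p) (hq : q ∈ feasible ν ψ a 0)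
    (fq : FiniteKL ν q) {ε : ℝ} (hε : 0 < ε) :
    ∀ᶠ n : ℕ in atTop, Real.exp (-(n * (kl ν p + ε))) ≤ (prodLaw ν).real (constr ψ a δ n) := by
  have hK := kl_nonneg hq.1
  -- Moving `p` slightly towards `q`, feasible at tolerance 0, makes the constraints strict and
  -- raises the relative entropy by at most `ε / 2`.
  let t : ℝ := min 1 (ε / (2 * (kl ν q + 1)))
  have ht0 : 0 < t := lt_min one_pos (by positivity)
  have ht1 : t ≤ 1 := min_le_left _ _
  have htε : t * kl ν q ≤ ε / 2 := by
    have h1 : t ≤ ε / (2 * (kl ν q + 1)) := min_le_right _ _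
    have h2 := mul_le_mul_of_nonneg_right h1 hK
    refine h2.trans ?_
    rw [div_mul_eq_mul_div, div_le_div_iff₀ (by positivity) two_pos]
    nlinarith
  obtain ⟨fr, hr⟩ := fp.combo hp.1 hq.1 fq ht0.le ht1
  have hmom i := integral_combo (hp.2.1 i) (hq.2.1 i) (1 - t) t
  have h := eventually_exp_le_measure_constr (a := a) hψ htail (hp.1.combo hq.1 ht0.le ht1) fr
    (fun i => (hmom i).1) hδ (fun i => ?_) ?_ (half_pos hε)
  · filter_upwards [h] with n hn
    refine le_trans (Real.exp_le_exp.2 (neg_le_neg ?_)) hn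
    refine mul_le_mul_of_nonneg_left ?_ n.cast_nonneg
    nlinarith [kl_nonneg hp.1]
  · rw [(hmom _).2]
    have h1 := abs_le.1 (hp.2.2.1 i)
    have h2 := abs_le.1 (hq.2.2.1 i)
    rw [abs_lt]
    constructor <;> nlinarith
  · rw [(hmom _).2]
    nlinarith [hp.2.2.2, hq.2.2.2]

/-- From `e^u ≤ 1 + u + u²` for `|u| ≤ 1`. It linearizes the exponential moment in the entropy
bound. -/
theorem integral_exp_smul_le {α : Type*} [MeasurableSpace α] {π : Measure α}
    [IsProbabilityMeasure π] {f : α → ℝ} (hf : Measurable f) {B s : ℝ} (hB : ∀ x, |f x| ≤ B)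
    (hs : 0 ≤ s) (hsB : s * B ≤ 1) :
    ∫ x, Real.exp (s * f x) ∂π ≤ 1 + s * ∫ x, f x ∂π + (s * B) ^ 2 := by
  have hfi : Integrable f π :=
    (integrable_const B).mono' hf.aestronglyMeasurable (.of_forall hB)
  have hi : Integrable (fun x => 1 + s * f x) π := (integrable_const 1).add (hfi.const_mul s)
  have hab x : |s * f x| ≤ s * B := by
    rw [abs_mul, abs_of_nonneg hs]
    exact mul_le_mul_of_nonneg_left (hB x) hs
  have hle x : Real.exp (s * f x) ≤ 1 + s * f x + (s * B) ^ 2 := by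
    have h1 := (abs_le.1 (Real.abs_exp_sub_one_sub_id_le ((hab x).trans hsB))).2
    have h2 : (s * f x) ^ 2 ≤ (s * B) ^ 2 := sq_le_sq' (neg_le_of_abs_le (hab x)) (le_of_abs_le (hab x))
    linarith
  have hei : Integrable (fun x => Real.exp (s * f x)) π :=
    (integrable_const (Real.exp (s * B))).mono' (hf.const_mul s).exp.aestronglyMeasurable
      (.of_forall fun x => by
        rw [Real.norm_of_nonneg (Real.exp_pos _).le]
        exact Real.exp_le_exp.2 (le_of_abs_le (hab x)))
  have := integral_mono hei (hi.add (integrable_const ((s * B) ^ 2))) hle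
  simp only [Pi.add_apply] at this
  rw [integral_add hi (integrable_const _), integral_add (integrable_const _) (hfi.const_mul s),
    integral_const_mul] at this
  simpa using this

theorem eventually_integral_cond_le (hψ : Dominated ψ) (hp : p ∈ feasible ν ψ a δ)
    (fp : FiniteKL ν p) (hmin : ∀ q ∈ feasible ν ψ a δ, FiniteKL ν q → kl ν p ≤ kl ν q)
    (hlow : ∀ ε : ℝ, 0 < ε → ∀ᶠ n : ℕ in atTop,
      Real.exp (-(n * (kl ν p + ε))) ≤ (prodLaw ν).real (constr ψ a δ n))
    {j : ℕ} (hj : 0 < j) {f : (Fin j → Ω) → ℝ} (hf : Measurable f) {B : ℝ}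
    (hB : ∀ x, |f x| ≤ B) {ε : ℝ} (hε : 0 < ε) :
    ∀ᶠ n : ℕ in atTop, ∫ ω, f (fun i : Fin j => ω i) ∂((prodLaw ν)[|constr ψ a δ n]) ≤
      ∫ x, f x ∂(Measure.pi fun _ : Fin j => withDens ν p) + ε := by
  have := hp.1.isProbabilityMeasure
  have hB0 : 0 ≤ B := by
    have : Nonempty Ω := nonempty_of_isProbabilityMeasure ν
    exact (abs_nonneg _).trans (hB (Classical.arbitrary _))
  have hj' : (0 : ℝ) < j := Nat.cast_pos.2 hj
  -- The scale `s` does not depend on `n`. The first bound allows the quadratic expansion; the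
  -- second makes its error `s * B ^ 2` at most `ε / 2`.
  let s : ℝ := min (1 / (B + 1)) (ε / (2 * (B ^ 2 + 1)))
  have hs : 0 < s := lt_min (by positivity) (by positivity)
  have hsB : s * B ≤ 1 := by
    have : s ≤ 1 / (B + 1) := min_le_left _ _
    rw [le_div_iff₀ (by positivity)] at this
    nlinarith
  have hsε : s * B ^ 2 ≤ ε / 2 := by
    have : s ≤ ε / (2 * (B ^ 2 + 1)) := min_le_right _ _
    rw [le_div_iff₀ (by positivity)] at this
    nlinarith
  -- There are `n / j ≥ n / (2j)` blocks, so this tolerance costs at most `s * ε / 2` per block.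
  filter_upwards [hlow (s * ε / (4 * j)) (by positivity), eventually_ge_atTop j] with n hn hjn
  have hn0 : 0 < n := hj.trans_le hjn
  have hPC : 0 < (prodLaw ν).real (constr ψ a δ n) := (Real.exp_pos _).trans_le hn
  have hC : prodLaw ν (constr ψ a δ n) ≠ 0 := fun h => by simp [Measure.real, h] at hPC
  have hN : 0 < n / j := Nat.div_pos hjn hj
  have hn2 : n ≤ 2 * j * (n / j) := by
    have h1 := Nat.div_add_mod n j
    have h2 := Nat.mod_lt n hj
    have h3 := Nat.le_mul_of_pos_right j hN
    rw [mul_assoc, two_mul]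
    omega
  have hmain := mul_kl_add_le hψ hp fp hmin hn0 hC (Nat.div_mul_le_self n j)
    (hf.const_mul s) (B := s * B) fun x => by
      rw [abs_mul, abs_of_pos hs]
      exact mul_le_mul_of_nonneg_left (hB x) hs.le
  rw [integral_const_mul] at hmain
  have hI := integral_exp_smul_le (π := Measure.pi fun _ : Fin j => withDens ν p) hf hB hs.le hsB
  set E := ∫ ω, f (fun i : Fin j => ω i) ∂((prodLaw ν)[|constr ψ a δ n])
  set A := ∫ x, f x ∂(Measure.pi fun _ : Fin j => withDens ν p)
  have hIpos : 0 < ∫ x, Real.exp (s * f x) ∂(Measure.pi fun _ : Fin j => withDens ν p) :=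
    integral_exp_pos ((integrable_const (Real.exp (s * B))).mono'
      (hf.const_mul s).exp.aestronglyMeasurable (.of_forall fun x => by
        rw [Real.norm_of_nonneg (Real.exp_pos _).le]
        exact Real.exp_le_exp.2 (mul_le_mul_of_nonneg_left (le_of_abs_le (hB x)) hs.le)))
  have hlogI := (Real.log_le_sub_one_of_pos hIpos).trans (sub_le_sub_right hI 1)
  have hlogP := Real.log_le_log (Real.exp_pos _) hn
  rw [Real.log_exp] at hlogP
  have hNr : (0 : ℝ) < ((n / j : ℕ) : ℝ) := Nat.cast_pos.2 hN
  have hn2r : (n : ℝ) ≤ 2 * j * ((n / j : ℕ) : ℝ) := by exact_mod_cast hn2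
  set N : ℝ := ((n / j : ℕ) : ℝ)
  have h1 := mul_le_mul_of_nonneg_left hlogI hNr.le
  have h2 : n * (s * ε / (4 * j)) ≤ N * (s * (ε / 2)) := by
    refine (mul_le_mul_of_nonneg_right hn2r (by positivity)).trans (le_of_eq ?_)
    field_simp
    norm_num
  have h3 : N * s * E ≤ N * s * (A + ε) := by
    have h4 : N * s * (s * B ^ 2) ≤ N * s * (ε / 2) :=
      mul_le_mul_of_nonneg_left hsε (by positivity)
    nlinarith
  exact le_of_mul_le_mul_left h3 (by positivity)

theorem tendsto_integral_cond (hψ : Dominated ψ) (hp : p ∈ feasible ν ψ a δ)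
    (fp : FiniteKL ν p) (hmin : ∀ q ∈ feasible ν ψ a δ, FiniteKL ν q → kl ν p ≤ kl ν q)
    (hlow : ∀ ε : ℝ, 0 < ε → ∀ᶠ n : ℕ in atTop,
      Real.exp (-(n * (kl ν p + ε))) ≤ (prodLaw ν).real (constr ψ a δ n))
    (j : ℕ) {f : (Fin j → Ω) → ℝ} (hf : Measurable f) {B : ℝ} (hB : ∀ x, |f x| ≤ B) :
    Tendsto (fun n : ℕ => ∫ ω, f (fun i : Fin j => ω i) ∂((prodLaw ν)[|constr ψ a δ n])) atTop
      (𝓝 (∫ x, f x ∂(Measure.pi fun _ : Fin j => withDens ν p))) := by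
  have := hp.1.isProbabilityMeasure
  rcases Nat.eq_zero_or_pos j with rfl | hj
  -- For `j = 0` there are no blocks to average over, but `f` is constant and only the total mass
  -- matters.
  · have hc x : f x = f fun i => i.elim0 := congrArg f (Subsingleton.elim _ _)
    refine tendsto_const_nhds.congr' ?_
    filter_upwards [hlow 1 one_pos] with n hn
    have hC : prodLaw ν (constr ψ a δ n) ≠ 0 := fun h => by
      have := (Real.exp_pos _).trans_le hn
      simp [Measure.real, h] at this
    have : IsProbabilityMeasure ((prodLaw ν)[|constr ψ a δ n]) := cond_isProbabilityMeasure hC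
    simp_rw [hc]
    simp
  · rw [Metric.tendsto_nhds]
    intro ε hε
    have h1 := eventually_integral_cond_le hψ hp fp hmin hlow hj hf hB (half_pos hε)
    -- The bound for `-f` gives the reverse inequality.
    have h2 := eventually_integral_cond_le hψ hp fp hmin hlow hj hf.neg (B := B)
      (fun x => by simpa using hB x) (half_pos hε)
    filter_upwards [h1, h2] with n h1 h2
    simp only [Pi.neg_apply, integral_neg] at h2
    rw [Real.dist_eq, abs_lt]
    constructor <;> linarith

end Microcanonical

namespace Microcanonical
open InformationTheory

variable {m : ℕ} {φ : Fin (m + 1) → ℝ → ℝ}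

/-! ### The observables on the half line -/

/-- The observables as functions on the half line. -/
def obs (φ : Fin (m + 1) → ℝ → ℝ) (i : Fin (m + 1)) (x : PosReal) : ℝ := φ i x

theorem Observables.continuous_obs (hφ : Observables φ) (i : Fin (m + 1)) :
    Continuous (obs φ i) :=
  (hφ.contDiffOn i).continuousOn.domRestrict

/-- Where all observables are at least 1, each is at most its own power `κ`, hence at most the next
one; so the growth condition passes on to the last observable. -/
theorem Observables.eventually_rpow_le (hφ : Observables φ) :
    ∃ κ : ℝ, 1 < κ ∧ ∀ i : Fin m, ∀ᶠ x in atTop, φ i.castSucc x ^ κ ≤ φ (Fin.last m) x := by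
  obtain ⟨κ, hκ, hgr⟩ := hφ.growth
  refine ⟨κ, hκ, fun i => ?_⟩
  filter_upwards [eventually_all.2 hgr, eventually_all.2 fun i =>
    (hφ.tendsto_atTop i).eventually_ge_atTop 1] with x hx h1
  have hmono : Monotone fun i => φ i x := Fin.monotone_iff_le_succ.2 fun i =>
    (Real.self_le_rpow_of_one_le (h1 i.castSucc) hκ.le).trans (hx i).le
  exact (hx i).le.trans (hmono (Fin.le_last _))

theorem Observables.dominated (hφ : Observables φ) : Dominated (obs φ) where
  measurable i := (hφ.continuous_obs i).measurable
  nonneg i x := (hφ.pos i x x.2).le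
  le i ε hε := by
    obtain ⟨κ, hκ, hgr⟩ := hφ.eventually_rpow_le
    have h1 := ((tendsto_rpow_atTop (sub_pos.2 hκ)).comp
      (hφ.tendsto_atTop i.castSucc)).eventually_ge_atTop (1 / ε)
    obtain ⟨X, hX⟩ := eventually_atTop.1 ((hgr i).and h1)
    -- Up to `Y` monotonicity bounds `φ_i` by the constant; beyond it `φ_i ^ (κ - 1) ≥ 1 / ε`, so
    -- `φ_i ≤ ε φ_i ^ κ ≤ ε φ_k`.
    let Y := max X 1
    have hY : 0 < Y := lt_max_of_lt_right one_pos
    refine ⟨φ i.castSucc Y, fun x => ?_⟩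
    have hK := hφ.pos i.castSucc Y hY
    have hx : 0 < (x : ℝ) := x.2
    have hp := hφ.pos i.castSucc x hx
    simp only [obs]
    rcases le_total (x : ℝ) Y with h | h
    · have := hφ.monotoneOn i.castSucc hx hY h
      have := mul_pos hε (hφ.pos (Fin.last m) x hx)
      linarith
    · obtain ⟨h2, h3⟩ := hX x ((le_max_left _ _).trans h)
      simp only [Function.comp_apply] at h3
      have h4 : φ i.castSucc x ^ κ = φ i.castSucc x ^ (κ - 1) * φ i.castSucc x := by
        rw [Real.rpow_sub_one hp.ne', div_mul_cancel₀ _ hp.ne']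
      rw [div_le_iff₀ hε] at h3
      have h5 : φ i.castSucc x ≤ ε * φ i.castSucc x ^ κ := by
        rw [h4]
        nlinarith
      have h6 := mul_le_mul_of_nonneg_left h2 hε.le
      linarith

/-! ### The cost of one large coordinate -/

theorem exists_eq_of_tendsto_atTop {f : ℝ → ℝ} {A y : ℝ} (hf : ContinuousOn f (Set.Ici A))
    (hlim : Tendsto f atTop atTop) (hy : f A ≤ y) : ∃ x, A ≤ x ∧ f x = y := by
  obtain ⟨b, hb, hAb⟩ := ((hlim.eventually_ge_atTop y).and (eventually_ge_atTop A)).exists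
  obtain ⟨x, hx, hfx⟩ := intermediate_value_Icc hAb (hf.mono Set.Icc_subset_Ici_self) ⟨hy, hb⟩
  exact ⟨x, hx.1, hfx⟩

theorem leb_Icc {x y : ℝ} (hx : 0 < x) :
    leb {z : PosReal | x ≤ z ∧ (z : ℝ) ≤ y} = ENNReal.ofReal (y - x) := by
  rw [leb, comap_subtype_coe_apply measurableSet_Ioi, ← Real.volume_Icc]
  congr 1
  ext z
  constructor
  · rintro ⟨w, hw, rfl⟩
    exact hw
  · exact fun hz => ⟨⟨z, hx.trans_le hz.1⟩, hz, rfl⟩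

theorem refLaw_real_ge (hφ : Observables φ) {x y K : ℝ} (hx : 0 < x) (hxy : x ≤ y)
    (hK : ∀ z ∈ Set.Icc x y, φ 0 z ≤ K) :
    Real.exp (-K) / (∫ x : PosReal, Real.exp (-φ 0 x) ∂leb) * (y - x) ≤
      (refLaw hφ : Measure PosReal).real {z : PosReal | x ≤ z ∧ (z : ℝ) ≤ y} := by
  have hm : MeasurableSet {z : PosReal | x ≤ z ∧ (z : ℝ) ≤ y} :=
    (measurableSet_le measurable_const measurable_subtype_coe).inter
      (measurableSet_le measurable_subtype_coe measurable_const)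
  have hZ := integral_exp_pos hφ.integrable_exp_neg
  have h1 : ENNReal.ofReal (Real.exp (-K) / (∫ x : PosReal, Real.exp (-φ 0 x) ∂leb) * (y - x)) ≤
      (refLaw hφ : Measure PosReal) {z : PosReal | x ≤ z ∧ (z : ℝ) ≤ y} := by
    change _ ≤ (leb.tilted fun x => -φ 0 x) _
    rw [tilted_apply' _ _ hm, ENNReal.ofReal_mul (by positivity), ← leb_Icc hx]
    rw [← setLIntegral_const]
    refine setLIntegral_mono' hm fun z hz => ENNReal.ofReal_le_ofReal ?_
    gcongr
    exact hK z hz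
  have := ENNReal.toReal_mono (measure_ne_top _ _) h1
  rwa [ENNReal.toReal_ofReal (mul_nonneg (by positivity) (sub_nonneg.2 hxy))] at this

/-- The values of `φ_k` between `n (c - η)` and `n (c + η)` are taken on an interval whose length is
bounded below by a power of `n`, by the upper bound on `φ_k'`. On it `φ_1 ≤ n η / 2`, so the density
of the reference law is at least `exp (-n η / 2) / Z`. -/
theorem Observables.subexponentialTail (hφ : Observables φ) :
    SubexponentialTail (refLaw hφ : Measure PosReal) (obs φ) := by
  intro c η hη hηc
  -- With `k ≥ 2` the first observable differs from the last and is dominated by it.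
  obtain ⟨m, rfl⟩ : ∃ k, m = k + 1 := ⟨m - 1, by have := hφ.two_le; omega⟩
  obtain ⟨C, M, hC, hM, hder⟩ := hφ.deriv_bounds
  set Z := ∫ x : PosReal, Real.exp (-φ 0 x) ∂leb with hZdef
  have hZ : 0 < Z := integral_exp_pos hφ.integrable_exp_neg
  set f := φ (Fin.last (m + 1)) with hf
  have hcη : 0 < c + η := by linarith
  -- This factor turns `φ_k ≤ n (c + η)` into `φ_i ≤ n η / 4 + K i`, at most `n η / 2` once `n` is
  -- large.
  choose K hK using fun i : Fin (m + 1) => hφ.dominated.le i (η / (4 * (c + η))) (by positivity)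
  let A := C + 1
  have hA : 0 < A := by positivity
  have hcont : ContinuousOn f (Set.Ioi 0) := (hφ.contDiffOn _).continuousOn
  have hN := tendsto_natCast_atTop_atTop (R := ℝ)
  -- The remaining factor `exp (-n η / 2)` absorbs the power of `n` and the constants.
  have hexp := ((tendsto_rpow_mul_exp_neg_mul_atTop_nhds_zero M (η / 2) (by positivity)).comp
    hN).eventually_lt_const (u := 2 * η / (Z * C * (c + η) ^ M)) (by positivity)
  filter_upwards [hexp, (hN.atTop_mul_const (sub_pos.2 hηc)).eventually_ge_atTop (f A),
    eventually_all.2 fun i => (hN.atTop_mul_const (show 0 < η / 4 by positivity)).eventually_ge_atTop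
      (K i), eventually_ge_atTop 1] with n hexp hfA hKn hn1
  have hn1 : (1 : ℝ) ≤ n := Nat.one_le_cast.2 hn1
  have hn0 : (0 : ℝ) < n := by linarith
  have hcA : ContinuousOn f (Set.Ici A) := hcont.mono fun x hx => hA.trans_le hx
  obtain ⟨x, hAx, hfx⟩ := exists_eq_of_tendsto_atTop hcA (hφ.tendsto_atTop _) hfA
  obtain ⟨y, hAy, hfy⟩ := exists_eq_of_tendsto_atTop hcA (hφ.tendsto_atTop _)
    (hfA.trans (mul_le_mul_of_nonneg_left (by linarith : c - η ≤ c + η) hn0.le))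
  have hx0 : 0 < x := hA.trans_le hAx
  have hmono : MonotoneOn f (Set.Ioi 0) := hφ.monotoneOn _
  have hxy : x < y := by
    by_contra! h
    have := hmono (hA.trans_le hAy) hx0 h
    rw [hfx, hfy] at this
    nlinarith
  have hbd z (hz : z ∈ Set.Icc x y) : n * (c - η) ≤ f z ∧ f z ≤ n * (c + η) := by
    have hz0 : 0 < z := hx0.trans_le hz.1
    exact ⟨hfx ▸ hmono hx0 hz0 hz.1, hfy ▸ hmono hz0 (hA.trans_le hAy) hz.2⟩
  have hsmall (i : Fin (m + 1)) z (hz : z ∈ Set.Icc x y) : φ i.castSucc z ≤ n * (η / 2) := by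
    have h1 := hK i ⟨z, hx0.trans_le hz.1⟩
    simp only [obs] at h1
    have h2 : η / (4 * (c + η)) * f z ≤ n * (η / 4) := by
      refine (mul_le_mul_of_nonneg_left (hbd z hz).2 (by positivity)).trans (le_of_eq ?_)
      field_simp
    have h3 := hKn i
    linarith
  -- The increment of `φ_k` is `2 η n`; the mean value theorem and the derivative bound at `ξ` limit
  -- how short the interval can be.
  obtain ⟨ξ, hξ, hslope⟩ := exists_deriv_eq_slope f hxy
    (hcont.mono fun z hz => hx0.trans_le hz.1)
    (((hφ.contDiffOn _).differentiableOn one_ne_zero).mono fun z hz => hx0.trans hz.1)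
  have hlen : 2 * η * n / (C * ((c + η) * n) ^ M) ≤ y - x := by
    have h1 := (hder (Fin.last (m + 1)) ξ (by linarith [hξ.1])).2
    have hξI : ξ ∈ Set.Icc x y := Set.Ioo_subset_Icc_self hξ
    have h2 : f ξ ^ M ≤ ((c + η) * n) ^ M := by
      refine Real.rpow_le_rpow (hφ.pos _ ξ (hx0.trans hξ.1)).le ?_ hM.le
      linarith [(hbd ξ hξI).2]
    rw [hslope, hfx, hfy, div_lt_iff₀ (sub_pos.2 hxy)] at h1
    rw [div_le_iff₀ (by positivity)]
    have h3 := mul_le_mul_of_nonneg_right (mul_le_mul_of_nonneg_left h2 hC.le) (sub_pos.2 hxy).le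
    nlinarith
  have hge := refLaw_real_ge hφ hx0 hxy.le (K := n * (η / 2)) (hsmall 0)
  refine le_trans ?_ (hge.trans (measureReal_mono fun z hz => ?_))
  · refine le_trans ?_ (mul_le_mul_of_nonneg_left hlen (by positivity))
    simp only [Function.comp_apply] at hexp
    rw [Real.mul_rpow hcη.le hn0.le]
    rw [lt_div_iff₀ (by positivity)] at hexp
    rw [show -(n * η) = -(n * (η / 2)) + -(η / 2) * n by ring, Real.exp_add, div_mul_div_comm,
      le_div_iff₀ (by positivity)]
    have h1 := mul_le_mul_of_nonneg_left hexp.le (Real.exp_pos (-(n * (η / 2)))).le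
    have h2 := mul_le_mul_of_nonneg_left hn1
      (show 0 ≤ Real.exp (-(n * (η / 2))) * (2 * η) by positivity)
    nlinarith
  · have := hbd z hz
    refine ⟨?_, fun i => (hsmall i z hz).trans ?_⟩
    · rw [abs_le]
      simp only [obs]
      constructor <;> linarith
    · nlinarith

end Microcanonical

namespace Microcanonical
open InformationTheory

variable {m : ℕ} {φ : Fin (m + 1) → ℝ → ℝ} {a : Fin (m + 1) → ℝ} {μ : ProbabilityMeasure PosReal}

instance instSigmaFiniteLeb : SigmaFinite leb := by
  refine SigmaFinite.of_map leb measurable_subtype_coe.aemeasurable ?_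
  rw [leb, map_comap_subtype_coe measurableSet_Ioi]
  infer_instance

/-! ### Moments -/

theorem integral_obs_of_moment_le (hφ : Observables φ) {i : Fin (m + 1)} {v : ℝ} (hv : 0 ≤ v)
    (h : moment (φ i) μ ≤ ENNReal.ofReal v) :
    Integrable (obs φ i) (μ : Measure PosReal) ∧
      ∫ x, obs φ i x ∂(μ : Measure PosReal) ≤ v := by
  have h0 : ∀ᵐ x ∂(μ : Measure PosReal), 0 ≤ obs φ i x := .of_forall (hφ.dominated.nonneg i)
  have hi : Integrable (obs φ i) (μ : Measure PosReal) := by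
    refine ⟨(hφ.dominated.measurable i).aestronglyMeasurable, ?_⟩
    rw [hasFiniteIntegral_iff_ofReal h0]
    exact h.trans_lt ENNReal.ofReal_lt_top
  refine ⟨hi, (ENNReal.ofReal_le_ofReal_iff hv).1 ?_⟩
  rwa [ofReal_integral_eq_lintegral_ofReal hi h0]

theorem moment_eq_ofReal_integral (hφ : Observables φ) {i : Fin (m + 1)}
    (hi : Integrable (obs φ i) (μ : Measure PosReal)) :
    moment (φ i) μ = ENNReal.ofReal (∫ x, obs φ i x ∂(μ : Measure PosReal)) :=
  (ofReal_integral_eq_lintegral_ofReal hi (.of_forall (hφ.dominated.nonneg i))).symm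

theorem dens_mem_feasible (hφ : Observables φ) (ha : ∀ i, 0 ≤ a i) (hμ : μ ∈ relaxedSet φ a)
    (hac : (μ : Measure PosReal) ≪ (refLaw hφ : Measure PosReal)) :
    dens (refLaw hφ : Measure PosReal) μ ∈ feasible (refLaw hφ : Measure PosReal) (obs φ) a 0 := by
  have hlast := integral_obs_of_moment_le hφ (ha _) hμ.2
  have hi (i : Fin m) := integral_obs_of_moment_le hφ (ha i.castSucc) (hμ.1 i).le
  refine ⟨isDensity_dens hac, fun i => (integrable_dens_mul_iff hac).2 ?_, fun i => ?_, ?_⟩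
  · induction i using Fin.lastCases with
    | last => exact hlast.1
    | cast i => exact (hi i).1
  · rw [integral_dens_mul hac]
    have h := hμ.1 i
    rw [moment_eq_ofReal_integral hφ (hi i).1, ENNReal.ofReal_eq_ofReal_iff
      (integral_nonneg (hφ.dominated.nonneg _)) (ha _)] at h
    simp [h]
  · rw [integral_dens_mul hac]
    linarith [hlast.2]

theorem mem_relaxedSet_of_feasible (hφ : Observables φ) {p : PosReal → ℝ}
    (hp : p ∈ feasible (refLaw hφ : Measure PosReal) (obs φ) a 0)
    (hμ : (μ : Measure PosReal) = withDens (refLaw hφ : Measure PosReal) p) :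
    μ ∈ relaxedSet φ a := by
  have h i : moment (φ i) μ =
      ENNReal.ofReal (∫ x, p x * obs φ i x ∂(refLaw hφ : Measure PosReal)) := by
    rw [moment_eq_ofReal_integral hφ, hμ, integral_withDens hp.1]
    rw [hμ, integrable_withDens_iff hp.1]
    exact hp.2.1 i
  refine ⟨fun i => ?_, ?_⟩
  · have := abs_nonpos_iff.1 (hp.2.2.1 i)
    rw [h, sub_eq_zero.1 this]
  · rw [h]
    exact ENNReal.ofReal_le_ofReal (by linarith [hp.2.2.2])

/-! ### The entropy formula -/

/-- The density of the reference law with respect to the Lebesgue measure. -/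
def refDens (φ : Fin (m + 1) → ℝ → ℝ) (x : PosReal) : ℝ :=
  Real.exp (-φ 0 x) / ∫ x : PosReal, Real.exp (-φ 0 x) ∂leb

theorem integral_refLaw (hφ : Observables φ) (g : PosReal → ℝ) :
    ∫ x, g x ∂(refLaw hφ : Measure PosReal) = ∫ x, refDens φ x * g x ∂leb :=
  integral_tilted _ _

theorem integrable_refLaw_iff (hφ : Observables φ) (g : PosReal → ℝ) :
    Integrable g (refLaw hφ : Measure PosReal) ↔ Integrable (fun x => refDens φ x * g x) leb := by
  have h0 x : 0 ≤ refDens φ x :=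
    div_nonneg (Real.exp_pos _).le (integral_nonneg fun _ => (Real.exp_pos _).le)
  have hm : Measurable (refDens φ) :=
    ((hφ.dominated.measurable 0).neg.exp).div_const _
  change Integrable g (leb.withDensity fun x => ENNReal.ofReal (refDens φ x)) ↔ _
  rw [integrable_withDensity_iff_integrable_smul' hm.ennreal_ofReal
    (.of_forall fun _ => ENNReal.ofReal_lt_top)]
  simp [ENNReal.toReal_ofReal (h0 _)]

theorem refLaw_ac (hφ : Observables φ) : (refLaw hφ : Measure PosReal) ≪ leb :=
  tilted_absolutelyContinuous _ _

theorem leb_ac_refLaw (hφ : Observables φ) : leb ≪ (refLaw hφ : Measure PosReal) :=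
  absolutelyContinuous_tilted hφ.integrable_exp_neg

theorem toReal_rnDeriv_leb (hφ : Observables φ)
    (hac : (μ : Measure PosReal) ≪ (refLaw hφ : Measure PosReal)) :
    ∀ᵐ x ∂leb, ((μ : Measure PosReal).rnDeriv leb x).toReal =
      dens (refLaw hφ : Measure PosReal) μ x * refDens φ x := by
  have h1 := Measure.rnDeriv_mul_rnDeriv (κ := leb) hac
  have h2 : (refLaw hφ : Measure PosReal).rnDeriv leb =ᵐ[leb]
      fun x => ENNReal.ofReal (refDens φ x) :=
    rnDeriv_tilted_left_self (hφ.dominated.measurable 0).neg.aemeasurable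
  filter_upwards [h1, h2] with x h1 h2
  rw [← h1, Pi.mul_apply, h2, ENNReal.toReal_mul, ENNReal.toReal_ofReal]
  · rfl
  · exact div_nonneg (Real.exp_pos _).le (integral_nonneg fun _ => (Real.exp_pos _).le)

theorem negMulLog_mul_refDens (hφ : Observables φ) {y : ℝ} (hy : 0 ≤ y) (x : PosReal) :
    Real.negMulLog (y * refDens φ x) =
      refDens φ x * (1 - y + y * (obs φ 0 x + Real.log (∫ x : PosReal, Real.exp (-φ 0 x) ∂leb))) -
        refDens φ x * klFun y := by
  have hZ : 0 < ∫ x : PosReal, Real.exp (-φ 0 x) ∂leb := integral_exp_pos hφ.integrable_exp_neg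
  rcases hy.eq_or_lt with rfl | hy
  · simp [klFun_zero]
  · have hw : Real.log (refDens φ x) =
        -obs φ 0 x - Real.log (∫ x : PosReal, Real.exp (-φ 0 x) ∂leb) := by
      rw [refDens, Real.log_div (Real.exp_pos _).ne' hZ.ne', Real.log_exp]
      rfl
    rw [Real.negMulLog, Real.log_mul hy.ne' (show refDens φ x ≠ 0 from (div_pos (Real.exp_pos _) hZ).ne'), hw, klFun_apply]
    ring

theorem entropy_of_not_ac (hφ : Observables φ)
    (h : ¬(μ : Measure PosReal) ≪ (refLaw hφ : Measure PosReal)) : entropy μ = ⊥ := by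
  rw [entropy, if_neg fun h' => h (h'.trans (leb_ac_refLaw hφ))]

/-- With respect to `dx`, the entropy integrand is `A - B`, where `A` is integrable because `φ_1`
is, and `B ≥ 0` is the relative entropy integrand. So the entropy is finite exactly when the
relative entropy is. -/
theorem entropy_eq (hφ : Observables φ)
    (hac : (μ : Measure PosReal) ≪ (refLaw hφ : Measure PosReal))
    (hi : Integrable (obs φ 0) (μ : Measure PosReal)) :
    (FiniteKL (refLaw hφ : Measure PosReal) (dens (refLaw hφ : Measure PosReal) μ) →
      entropy μ = ((∫ x, obs φ 0 x ∂(μ : Measure PosReal) +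
        Real.log (∫ x : PosReal, Real.exp (-φ 0 x) ∂leb) -
        kl (refLaw hφ : Measure PosReal) (dens (refLaw hφ : Measure PosReal) μ) : ℝ) : EReal)) ∧
    (¬FiniteKL (refLaw hφ : Measure PosReal) (dens (refLaw hφ : Measure PosReal) μ) →
      entropy μ = ⊥) := by
  set ν := (refLaw hφ : Measure PosReal)
  set q := dens ν μ
  have hq : IsDensity ν q := isDensity_dens hac
  set L := Real.log (∫ x : PosReal, Real.exp (-φ 0 x) ∂leb)
  have hw0 x : 0 ≤ refDens φ x :=
    div_nonneg (Real.exp_pos _).le (integral_nonneg fun _ => (Real.exp_pos _).le)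
  have hwm : Measurable (refDens φ) := (hφ.dominated.measurable 0).neg.exp.div_const _
  let A (x : PosReal) : ℝ := refDens φ x * (1 - q x + q x * (obs φ 0 x + L))
  let B (x : PosReal) : ℝ := refDens φ x * klFun (q x)
  have hB0 x : 0 ≤ B x := mul_nonneg (hw0 x) (hq.klFun_nonneg x)
  have hBm : Measurable B := hwm.mul hq.measurable_klFun
  have hρ : ∀ᵐ x ∂leb, Real.negMulLog ((μ : Measure PosReal).rnDeriv leb x).toReal =
      A x - B x := by
    filter_upwards [toReal_rnDeriv_leb hφ hac] with x hx
    rw [hx, negMulLog_mul_refDens hφ (hq.nonneg x)]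
  have h1 : Integrable (fun x => 1 - q x) ν := (integrable_const 1).sub hq.integrable
  have h2 : Integrable (fun x => q x * (obs φ 0 x + L)) ν :=
    (integrable_dens_mul_iff hac).2 (hi.add (integrable_const L))
  have hAi : Integrable A leb := (integrable_refLaw_iff hφ _).1 (h1.add h2)
  have hAint : ∫ x, A x ∂leb = ∫ x, obs φ 0 x ∂(μ : Measure PosReal) + L := by
    rw [← integral_refLaw hφ fun x => 1 - q x + q x * (obs φ 0 x + L), integral_add h1 h2,
      integral_sub (integrable_const 1) hq.integrable, hq.integral_eq_one,
      integral_dens_mul hac fun x => obs φ 0 x + L, integral_add hi (integrable_const L)]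
    simp
  have hent : entropy μ = ((∫⁻ x, ENNReal.ofReal (A x - B x) ∂leb : ENNReal) : EReal) -
      ((∫⁻ x, ENNReal.ofReal (-(A x - B x)) ∂leb : ENNReal) : EReal) := by
    rw [entropy, if_pos (hac.trans (refLaw_ac hφ)),
      lintegral_congr_ae (hρ.mono fun x hx => congrArg ENNReal.ofReal hx),
      lintegral_congr_ae (hρ.mono fun x hx => congrArg (fun t => ENNReal.ofReal (-t)) hx)]
  have hBi : Integrable B leb ↔ FiniteKL ν q := (integrable_refLaw_iff hφ _).symm
  refine ⟨fun hf => ?_, fun hf => ?_⟩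
  · have hABi : Integrable (fun x => A x - B x) leb := hAi.sub (hBi.2 hf)
    have hval : ∫ x, A x - B x ∂leb = ∫ x, obs φ 0 x ∂(μ : Measure PosReal) + L - kl ν q := by
      rw [integral_sub hAi (hBi.2 hf), hAint, ← integral_refLaw hφ fun x => klFun (q x)]
      rfl
    rw [integral_eq_lintegral_pos_part_sub_lintegral_neg_part hABi] at hval
    have hfin1 : ∫⁻ x, ENNReal.ofReal (A x - B x) ∂leb ≠ ⊤ :=
      (hABi.lintegral_lt_top).ne
    have hfin2 : ∫⁻ x, ENNReal.ofReal (-(A x - B x)) ∂leb ≠ ⊤ :=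
      (hABi.neg.lintegral_lt_top).ne
    rw [hent, ← hval, EReal.coe_sub, EReal.coe_ennreal_toReal hfin1,
      EReal.coe_ennreal_toReal hfin2]
  · have htop : ∫⁻ x, ENNReal.ofReal (-(A x - B x)) ∂leb = ⊤ := by
      by_contra hne
      refine hf (hBi.1 ⟨hBm.aestronglyMeasurable, ?_⟩)
      rw [hasFiniteIntegral_iff_ofReal (.of_forall hB0)]
      -- `B` is at most the positive part of `A` plus the negative part of `A - B`, so a finite
      -- negative part would make `B` integrable.
      refine (lintegral_mono (g := fun x => ENNReal.ofReal (A x) + ENNReal.ofReal (-(A x - B x)))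
        fun x => ?_).trans_lt ?_
      · rw [show B x = A x + -(A x - B x) by ring]
        refine ENNReal.ofReal_add_le.trans (le_of_eq ?_)
        congr 2
      · rw [lintegral_add_left' hAi.aestronglyMeasurable.aemeasurable.ennreal_ofReal]
        exact ENNReal.add_lt_top.2 ⟨hAi.lintegral_lt_top, lt_top_iff_ne_top.2 hne⟩
    -- In `EReal` subtracting `⊤` gives `⊥`, whatever the positive part.
    rw [hent, htop]
    simp

end Microcanonical

namespace Microcanonical
open InformationTheory

variable {m : ℕ} {φ : Fin (m + 1) → ℝ → ℝ} {a : Fin (m + 1) → ℝ}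

/-! ### Entropy projections on the half line and the entropy maximizer -/

theorem nonneg_of_mem_admissible (ha : a ∈ admissible φ) (i : Fin (m + 1)) : 0 ≤ a i := by
  induction i using Fin.lastCases with
  | last => exact (ENNReal.ofReal_pos.1 (bot_le.trans_lt ha.2)).le
  | cast i => exact ((interior_subset ha.1).1 i).le

/-- Since `k ≥ 2`, the first moment is prescribed by an equality. The linear term of the entropy
formula is therefore constant on the relaxed set. -/
theorem integrable_obs_zero_of_mem_relaxedSet (hφ : Observables φ) (ha : ∀ i, 0 ≤ a i)
    {μ : ProbabilityMeasure PosReal} (hμ : μ ∈ relaxedSet φ a) :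
    Integrable (obs φ 0) (μ : Measure PosReal) ∧ ∫ x, obs φ 0 x ∂(μ : Measure PosReal) = a 0 := by
  obtain ⟨m, rfl⟩ : ∃ k, m = k + 1 := ⟨m - 1, by have := hφ.two_le; omega⟩
  have h := hμ.1 0
  have hi := (integral_obs_of_moment_le hφ (ha _) h.le).1
  refine ⟨hi, ?_⟩
  rw [moment_eq_ofReal_integral hφ hi, ENNReal.ofReal_eq_ofReal_iff
    (integral_nonneg (hφ.dominated.nonneg _)) (ha _)] at h
  exact h

theorem finiteKL_of_entropy_ne_bot (hφ : Observables φ) (ha : ∀ i, 0 ≤ a i)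
    {μ : ProbabilityMeasure PosReal} (hμ : μ ∈ relaxedSet φ a) (h : entropy μ ≠ ⊥) :
    (μ : Measure PosReal) ≪ (refLaw hφ : Measure PosReal) ∧
      FiniteKL (refLaw hφ : Measure PosReal) (dens (refLaw hφ : Measure PosReal) μ) := by
  have hac : (μ : Measure PosReal) ≪ (refLaw hφ : Measure PosReal) := by
    by_contra hac
    exact h (entropy_of_not_ac hφ hac)
  refine ⟨hac, ?_⟩
  by_contra hf
  exact h ((entropy_eq hφ hac (integrable_obs_zero_of_mem_relaxedSet hφ ha hμ).1).2 hf)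

theorem exists_feasible_finiteKL (hφ : Observables φ) (ha : a ∈ admissible φ) :
    ∃ q ∈ feasible (refLaw hφ : Measure PosReal) (obs φ) a 0,
      FiniteKL (refLaw hφ : Measure PosReal) q := by
  have h0 := nonneg_of_mem_admissible ha
  obtain ⟨_, ⟨μ, hμ, hmom, rfl⟩, hlt⟩ := sInf_lt_iff.1 ha.2
  have hT : μ ∈ relaxedSet φ a := ⟨hmom, hlt.le⟩
  obtain ⟨hac, hf⟩ := finiteKL_of_entropy_ne_bot hφ h0 hT hμ
  exact ⟨_, dens_mem_feasible hφ h0 hT hac, hf⟩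

section densities

variable {Ω : Type*} [MeasurableSpace Ω] {ν : Measure Ω} {p q : Ω → ℝ}

/-- The probability measure with density `p`. -/
def probDens (hp : IsDensity ν p) : ProbabilityMeasure Ω := ⟨withDens ν p, hp.isProbabilityMeasure⟩

theorem dens_withDens [IsProbabilityMeasure ν] (hp : IsDensity ν p) :
    dens ν (withDens ν p) =ᵐ[ν] p := by
  filter_upwards [Measure.rnDeriv_withDensity ν hp.measurable.ennreal_ofReal] with x hx
  rw [dens, withDens, hx, ENNReal.toReal_ofReal (hp.nonneg x)]

theorem withDens_eq_of_hellinger_eq_zero (hp : IsDensity ν p) (hq : IsDensity ν q)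
    (h : ∫ x, (√(p x) - √(q x)) ^ 2 ∂ν ≤ 0) : withDens ν p = withDens ν q := by
  have h0 := (integral_eq_zero_iff_of_nonneg (fun x => sq_nonneg _)
    (integrable_hellinger hp hq)).1 (le_antisymm h (integral_nonneg fun x => sq_nonneg _))
  refine withDensity_congr_ae (h0.mono fun x hx => ?_)
  have : √(p x) - √(q x) = 0 := pow_eq_zero_iff two_ne_zero |>.1 hx
  exact congrArg ENNReal.ofReal
    ((Real.sqrt_inj (hp.nonneg x) (hq.nonneg x)).1 (sub_eq_zero.1 this))

theorem abs_integral_withDens_sub_le (hp : IsDensity ν p) (hq : IsDensity ν q) {f : Ω → ℝ}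
    (hf : Measurable f) {B : ℝ} (hB : ∀ x, |f x| ≤ B) :
    |∫ x, f x ∂(withDens ν p) - ∫ x, f x ∂(withDens ν q)| ≤ B * ∫ x, |p x - q x| ∂ν := by
  have hi {r : Ω → ℝ} (hr : IsDensity ν r) : Integrable (fun x => r x * f x) ν :=
    hr.integrable.mul_bdd hf.aestronglyMeasurable (.of_forall hB)
  rw [integral_withDens hp, integral_withDens hq, ← integral_sub (hi hp) (hi hq),
    ← integral_const_mul]
  refine (abs_integral_le_integral_abs).trans (integral_mono ((hi hp).sub (hi hq)).abs
    ((hp.integrable.sub hq.integrable).abs.const_mul B) fun x => ?_)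
  simp only
  rw [← sub_mul, abs_mul, mul_comm]
  exact mul_le_mul_of_nonneg_right (hB x) (abs_nonneg _)

/-- The entropy projections on the relaxed constraints converge as the tolerance tends to `0`. -/
theorem tendsto_integral_abs_sub {ψ : Fin (m + 1) → Ω → ℝ} (hψ : Dominated ψ) {P : ℝ → Ω → ℝ}
    (hP : ∀ δ, 0 ≤ δ → P δ ∈ feasible ν ψ a δ ∧ FiniteKL ν (P δ) ∧
      ∀ q ∈ feasible ν ψ a δ, FiniteKL ν q → kl ν (P δ) ≤ kl ν q) :
    Tendsto (fun δ => ∫ x, |P δ x - P 0 x| ∂ν) (𝓝[>] 0) (𝓝 0) := by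
  obtain ⟨h0, f0, m0⟩ := hP 0 le_rfl
  rw [Metric.tendsto_nhds]
  intro ε hε
  let c := ε / 4
  have hc : 0 < c := by positivity
  -- An entropy gap below `c ^ 2` gives squared Hellinger distance below `2 * c ^ 2`, hence L¹
  -- distance at most `3 * c < ε`.
  obtain ⟨δ₀, hδ₀, hlt⟩ := exists_forall_lt_kl hψ m0 (ε := c ^ 2) (by positivity)
  filter_upwards [Ioo_mem_nhdsGT hδ₀] with δ hδ
  obtain ⟨hδm, hδf, hδmin⟩ := hP δ hδ.1.le
  -- The minimizer for tolerance 0 is a competitor of `P δ` in the larger set.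
  have h1 := hellinger_le_of_isMin convex_feasible (fun _ h => h.1) hδm hδf hδmin
    (feasible_mono hδ.1.le h0) f0
  have h2 := integral_abs_sub_le hδm.1 h0.1 hc
  have h3 := hlt δ hδ.2.le _ hδm hδf
  have h4 : (∫ x, (√(P δ x) - √(P 0 x)) ^ 2 ∂ν) / (2 * c) ≤ c := by
    rw [div_le_iff₀ (by positivity)]
    nlinarith
  rw [Real.dist_eq, sub_zero, abs_of_nonneg (integral_nonneg fun x => abs_nonneg _)]
  have : c = ε / 4 := rfl
  linarith

end densities

/-- On the relaxed set maximizing entropy means minimizing relative entropy; a second maximizer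
would be at Hellinger distance 0 from the first. -/
theorem isUniqueEntropyMaximizer_probDens (hφ : Observables φ) (ha : ∀ i, 0 ≤ a i)
    {p : PosReal → ℝ} (hp : p ∈ feasible (refLaw hφ : Measure PosReal) (obs φ) a 0)
    (fp : FiniteKL (refLaw hφ : Measure PosReal) p)
    (hmin : ∀ q ∈ feasible (refLaw hφ : Measure PosReal) (obs φ) a 0,
      FiniteKL (refLaw hφ : Measure PosReal) q →
        kl (refLaw hφ : Measure PosReal) p ≤ kl (refLaw hφ : Measure PosReal) q) :
    IsUniqueEntropyMaximizer (relaxedSet φ a) (probDens hp.1) := by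
  have hT : probDens hp.1 ∈ relaxedSet φ a := mem_relaxedSet_of_feasible hφ hp rfl
  refine ⟨hT, fun μ hμ hne => ?_⟩
  have hae := dens_withDens hp.1
  have hae' : (fun x => klFun (dens (refLaw hφ : Measure PosReal)
      (withDens (refLaw hφ : Measure PosReal) p) x)) =ᵐ[(refLaw hφ : Measure PosReal)]
      fun x => klFun (p x) := hae.mono fun x hx => congrArg klFun hx
  have hac : (probDens hp.1 : Measure PosReal) ≪ (refLaw hφ : Measure PosReal) :=
    withDensity_absolutelyContinuous _ _
  have hkl : kl (refLaw hφ : Measure PosReal) (dens (refLaw hφ : Measure PosReal)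
      (probDens hp.1 : Measure PosReal)) = kl (refLaw hφ : Measure PosReal) p :=
    integral_congr_ae hae'
  obtain ⟨hi, hint⟩ := integrable_obs_zero_of_mem_relaxedSet hφ ha hT
  rw [(entropy_eq hφ hac hi).1 (Integrable.congr fp hae'.symm), hint, hkl]
  rcases eq_or_ne (entropy μ) ⊥ with hbot | hbot
  · rw [hbot]
    exact EReal.bot_lt_coe _
  obtain ⟨hacμ, hf⟩ := finiteKL_of_entropy_ne_bot hφ ha hμ hbot
  obtain ⟨hiμ, hintμ⟩ := integrable_obs_zero_of_mem_relaxedSet hφ ha hμ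
  rw [(entropy_eq hφ hacμ hiμ).1 hf, hintμ, EReal.coe_lt_coe_iff]
  by_contra! hge
  refine hne (Subtype.ext ?_)
  have hq := dens_mem_feasible hφ ha hμ hacμ
  have hH := hellinger_le_of_isMin convex_feasible (fun _ h => h.1) hp fp hmin hq hf
  have heq := withDens_eq_of_hellinger_eq_zero hp.1 hq.1 (hH.trans (by linarith))
  rw [withDens_dens hacμ] at heq
  exact heq.symm

theorem tendsto_condMarginal (hφ : Observables φ) {δ : ℝ} {p : PosReal → ℝ} (hp : IsDensity (refLaw hφ : Measure PosReal) p)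
    (j : ℕ) (h : ∀ f : (Fin j → PosReal) → ℝ, Measurable f → ∀ B : ℝ, (∀ x, |f x| ≤ B) →
      Tendsto (fun n : ℕ => ∫ ω, f (fun i : Fin j => ω i)
        ∂((prodLaw (refLaw hφ : Measure PosReal))[|constr (obs φ) a δ n])) atTop
        (𝓝 (∫ x, f x ∂(Measure.pi fun _ : Fin j => withDens (refLaw hφ : Measure PosReal) p)))) :
    Tendsto (fun n : ℕ => condMarginal hφ a δ n j) atTop
      (𝓝 (ProbabilityMeasure.pi fun _ : Fin j => probDens hp).toFiniteMeasure) := by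
  rw [FiniteMeasure.tendsto_iff_forall_integral_tendsto]
  intro f
  refine (h f f.continuous.measurable ‖f‖ fun x => f.norm_coe_le_norm x).congr fun n => ?_
  have hm : Measurable fun (ω : Config) (i : Fin j) => ω i :=
    measurable_pi_iff.2 fun _ => measurable_pi_apply _
  exact (integral_map hm.aemeasurable
    f.continuous.measurable.aestronglyMeasurable).symm

theorem tendsto_probDens (hφ : Observables φ) {P : ℝ → PosReal → ℝ}
    (hd : ∀ δ, IsDensity (refLaw hφ : Measure PosReal) (P δ))
    (h : Tendsto (fun δ => ∫ x, |P δ x - P 0 x| ∂(refLaw hφ : Measure PosReal)) (𝓝[>] 0) (𝓝 0)) :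
    Tendsto (fun δ => probDens (hd δ)) (𝓝[>] 0) (𝓝 (probDens (hd 0))) := by
  rw [ProbabilityMeasure.tendsto_iff_forall_integral_tendsto]
  intro f
  rw [tendsto_iff_dist_tendsto_zero]
  refine squeeze_zero (fun _ => dist_nonneg) (fun δ => ?_) (by simpa using h.const_mul ‖f‖)
  exact abs_integral_withDens_sub_le (hd δ) (hd 0) f.continuous.measurable
    fun x => f.norm_coe_le_norm x

theorem exists_projections (hφ : Observables φ) (ha : a ∈ admissible φ) :
    ∃ P : ℝ → PosReal → ℝ, (∀ δ, IsDensity (refLaw hφ : Measure PosReal) (P δ)) ∧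
      ∀ δ, 0 ≤ δ → P δ ∈ feasible (refLaw hφ : Measure PosReal) (obs φ) a δ ∧
        FiniteKL (refLaw hφ : Measure PosReal) (P δ) ∧
        ∀ q ∈ feasible (refLaw hφ : Measure PosReal) (obs φ) a δ,
          FiniteKL (refLaw hφ : Measure PosReal) q →
            kl (refLaw hφ : Measure PosReal) (P δ) ≤ kl (refLaw hφ : Measure PosReal) q := by
  obtain ⟨q, hq, fq⟩ := exists_feasible_finiteKL hφ ha
  -- Truncating `δ` at 0 makes `P δ` a density for every real `δ`.
  have h (δ : ℝ) := exists_feasible_isMin (δ := max δ 0) hφ.dominated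
    ⟨q, feasible_mono (le_max_right δ 0) hq, fq⟩
  choose P hP fP hmin using h
  refine ⟨P, fun δ => (hP δ).1, fun δ hδ => ?_⟩
  have h1 := hP δ
  have h2 := hmin δ
  rw [max_eq_left hδ] at h1 h2
  exact ⟨h1, fP δ, h2⟩

end Microcanonical

end

/-! ### The conditional limit theorem -/

theorem theorem1p1 {m : ℕ} {φ : Fin (m + 1) → ℝ → ℝ} (hφ : Microcanonical.Observables φ)
    (hg : ContinuousOn (Microcanonical.g₁ φ) (Microcanonical.admissible₁ φ))
    (a : Fin (m + 1) → ℝ) (ha : a ∈ Microcanonical.admissible φ) :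
    (∀ δ : ℝ, 0 < δ → ∀ᶠ n : ℕ in atTop,
      0 < Microcanonical.refMeasure hφ (Microcanonical.constraint φ a δ n)) ∧
    ∃ lamStar : ProbabilityMeasure Microcanonical.PosReal,
      Microcanonical.IsUniqueEntropyMaximizer (Microcanonical.relaxedSet φ a) lamStar ∧
      ∀ j : ℕ, ∃ ν : ℝ → ProbabilityMeasure (Fin j → Microcanonical.PosReal),
        (∀ δ : ℝ, 0 < δ → Tendsto (fun n : ℕ => Microcanonical.condMarginal hφ a δ n j) atTop
          (𝓝 (ν δ).toFiniteMeasure)) ∧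
        Tendsto ν (𝓝[>] 0) (𝓝 (ProbabilityMeasure.pi fun _ => lamStar)) := by
  -- The continuity assumption `hg` is not needed: `g₁ φ v < a_k` already provides a law of finite
  -- entropy that satisfies the constraints strictly.
  obtain ⟨q, hq, fq⟩ := Microcanonical.exists_feasible_finiteKL hφ ha
  obtain ⟨P, hd, hP⟩ := Microcanonical.exists_projections hφ ha
  have hlow δ (hδ : 0 < δ) ε (hε : (0 : ℝ) < ε) :=
    Microcanonical.eventually_exp_le_of_isMin hφ.dominated hφ.subexponentialTail hδ
      (hP δ hδ.le).1 (hP δ hδ.le).2.1 hq fq hε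
  refine ⟨fun δ hδ => ?_, Microcanonical.probDens (hd 0), ?_, fun j => ?_⟩
  · filter_upwards [hlow δ hδ 1 one_pos] with n hn
    exact (ENNReal.toReal_pos_iff.1 ((Real.exp_pos _).trans_le hn)).1
  · exact Microcanonical.isUniqueEntropyMaximizer_probDens hφ
      (Microcanonical.nonneg_of_mem_admissible ha) (hP 0 le_rfl).1 (hP 0 le_rfl).2.1
      (hP 0 le_rfl).2.2
  · refine ⟨fun δ => ProbabilityMeasure.pi fun _ => Microcanonical.probDens (hd δ),
      fun δ hδ => ?_, ?_⟩
    · exact Microcanonical.tendsto_condMarginal hφ (hd δ) j fun f hf B hB =>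
        Microcanonical.tendsto_integral_cond hφ.dominated (hP δ hδ.le).1 (hP δ hδ.le).2.1
          (hP δ hδ.le).2.2 (hlow δ hδ) j hf hB
    · exact (ProbabilityMeasure.continuous_pi.tendsto _).comp (tendsto_pi_nhds.2 fun _ =>
        Microcanonical.tendsto_probDens hφ hd
          (Microcanonical.tendsto_integral_abs_sub hφ.dominated hP))
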